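/- **Setting.** In the black box model an input $x=(x_0,\dots,x_{N-1})\in\{0,1\}^N$ is accessed by queries $O_x:|z;i\rangle\mapsto(-1)^{x_i}|z;i\rangle$ if $i<N$ and $|z;i\rangle\mapsto|z;i\rangle$ if $i\ge N$; an algorithm with $T$ queries is a unitary of the form $(UO_x)^TU$, applied to $|0\rangle$ and followed by a measurement in the computational basis (the registers $z,i$ range over finite initial segments of the non-negative integers). Searching an ordered list of $N\ge 1$ elements means computing $f(x)=\min\{i : x_i=1\}$, read off from the $\lceil\log_2N\rceil$ rightmost bits of the final state, for every non-decreasing $x\in\{0,1\}^N$ with $x\ne 0$. It is done *exactly* if the correct answer is observed with probability $1$ for every such $x$. **The recursive pebbling algorithm.** For $N\le 8$ use any search circuit with at most $3$ queries that takes its start state exactly to a basis state $|f(x)\rangle$ depending only on $f(x)$, with distinct states for distinct answers. For $N>8$ let $L$ be the least even number $\ge N$ (if $N$ is odd, the input is padded by repeating its last element), $N'=\lfloor \frac13L+\log_2L\rfloor$, and $s=\lfloor\log_4(L/2)\rfloor$. Take a binary tree with $L$ leaves, labelled $0,\dots,L-1$ from left to right, and with pebbles of $2^s$ colors on its internal vertices,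 $p_v$ of them on vertex $v$, such that: every path from the root to a leaf contains exactly one pebble of each color; $p_v$ is at least the total number of pebbles on the proper ancestors of $v$; for every $v$, either $p_v$ equals that total or there are no pebbles on the proper ancestors of $v$; and all colors have the same number of pebbles, at most $N'$. (Such coverings exist.) The algorithm 1. prepares the uniform superposition of all colors $c$; 2. for all colors in parallel, applies recursively the algorithm for inputs of length $M$, the even one of $N'$ and $N'+1$, to find the unique vertex $v_c$ with a pebble of color $c$ whose subtree contains the leaf $f(x)$, the $j$-th vertex of color $c$ (from left to right) being represented by the bit of $x$ at the rightmost leaf below it, and missing items by $x_{N-1}$; 3. applies the inverse of $U_1:|v\rangle|0\rangle\mapsto|v\rangle\, p_v^{-1/2}\sum_{c\text{ on }v}|c\rangle$; 4. makes one query, implementing $O'_x$, which, with $i$ the rightmost leaf of the left subtree of $v$, maps $|v\rangle$ to $|v;x_i\rangle$ if there are no pebbles on the parent of $v$ (or $v$ is the root), and to $(-1)^{x_i}|v\rangle$ otherwise; then applies $U_2$, which, for pebbled $v$, maps $|v;0\rangle\mapsto|\Phi_{\mathrm{right}(v)}\rangle$ and $|v;1\rangle\mapsto|\Phi_{\mathrm{left}(v)}\rangle$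 if there are no pebbles on the parent of $v$ (or $v$ is the root), and $|v\rangle\mapsto\frac1{\sqrt2}(|\Phi_{\mathrm{right}(v)}\rangle-|\Phi_{\mathrm{left}(v)}\rangle)$ otherwise. Here $|\Phi_u\rangle=\sum_\ell 2^{-d(u,\ell)/2}|\ell\rangle$, summed over the leaves $\ell$ below $u$, with $d(u,\ell)$ the difference of depths. The operators are extended arbitrarily to unitaries, and the resulting circuit is written, without additional queries, in the form $(UO_x)^TU$. **Theorem.** There is a constant $K$ such that for every $N\ge 1$ the recursive pebbling algorithm can be carried out in the black box model on inputs of length $N$, and every algorithm obtained in this way searches an ordered list of $N$ elements exactly and uses at most $\log_3(N)+K$ queries. -/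

import Mathlib

open scoped Matrix

noncomputable section

namespace OrderedSearch

/-! ### Inputs and the search function -/

/-- The oracle bit `x_i`, read as `false` beyond the end of the input. -/
def bit {N : ℕ} (x : Fin N → Bool) (i : ℕ) : Bool :=
  if h : i < N then x ⟨i, h⟩ else false

/-- The phase picked up by a query with index `i`: it is `(-1) ^ x_i` if `i < N`, and `1` if
`N ≤ i`. -/
def phase {N : ℕ} (x : Fin N → Bool) (i : ℕ) : ℂ :=
  if bit x i then -1 else 1

/-- The ordered `N`-bit strings of non-zero Hamming weight. -/
def orderedInputs (N : ℕ) : Set (Fin N → Bool) :=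
  {x | Monotone x ∧ ∃ i, x i = true}

/-- The search function: the position of the leftmost `1`. -/
def leftmostOne {N : ℕ} (x : Fin N → Bool) : ℕ :=
  sInf {i | bit x i = true}

/-! ### States and oracles -/

/-- The computational basis state labelled `b`. -/
def ket {ι : Type} [DecidableEq ι] (b : ι) : ι → ℂ := Pi.single b 1

/-- The query operator for input `x` on a space with basis `ι`, where the basis state `b` has
`idx b` in its index register. -/
def oracle {ι : Type} [DecidableEq ι] {N : ℕ} (idx : ι → ℕ) (x : Fin N → Bool) :
    Matrix ι ι ℂ :=
  Matrix.diagonal fun b => phase x (idx b)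

/-! ### The black box model -/

/-- A black box algorithm with `T` queries, `(U O) ^ T U`.  The basis states are `|z; i⟩`, with
`z` and `i` non-negative integers that range over finite initial segments, and `i` is the index
that is queried. -/
structure BlackBoxAlgorithm where
  zMax : ℕ
  iMax : ℕ
  T : ℕ
  U : Matrix.unitaryGroup (Fin (zMax + 1) × Fin (iMax + 1)) ℂ

namespace BlackBoxAlgorithm

/-- The labels `(z, i)` of the computational basis. -/
abbrev Basis (B : BlackBoxAlgorithm) : Type := Fin (B.zMax + 1) × Fin (B.iMax + 1)

/-- The state `(U O_x) ^ j U |0⟩` after `j` queries. -/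
def state (B : BlackBoxAlgorithm) {N : ℕ} (x : Fin N → Bool) (j : ℕ) : B.Basis → ℂ :=
  (((B.U : Matrix B.Basis B.Basis ℂ) * oracle (fun b : B.Basis => (b.2 : ℕ)) x) ^ j *
    (B.U : Matrix B.Basis B.Basis ℂ)) *ᵥ ket ((0, 0) : B.Basis)

/-- The probability that the `m` rightmost bits of the final state are observed to be the
binary encoding of `k`. -/
def prob (B : BlackBoxAlgorithm) {N : ℕ} (x : Fin N → Bool) (m k : ℕ) : ℝ :=
  ∑ b : B.Basis, if (b.2 : ℕ) % 2 ^ m = k then ‖B.state x B.T b‖ ^ 2 else 0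

/-- The algorithm computes `f : S → {0,1}^m` with error probability at most `ε`. -/
def Computes (B : BlackBoxAlgorithm) {N : ℕ} (S : Set (Fin N → Bool)) (m : ℕ)
    (f : (Fin N → Bool) → ℕ) (ε : ℝ) : Prop :=
  ∀ x ∈ S, 1 - ε ≤ B.prob x m (f x)

end BlackBoxAlgorithm

/-! ### Circuits: a form of query algorithm that is convenient for describing recursion -/

/-- A query circuit: the unitary operators `U 0, …, U queries`, with one query between any two
consecutive ones, on a space with basis `ι`.  The index register of `b` holds `idx b`, and the
basis state `ans k` stands for the answer `k`. -/
structure Circuit where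
  ι : Type
  fin : Fintype ι
  dec : DecidableEq ι
  queries : ℕ
  U : ℕ → Matrix.unitaryGroup ι ℂ
  idx : ι → ℕ
  start : ι
  ans : ℕ → ι

attribute [instance] Circuit.fin Circuit.dec

namespace Circuit

/-- The state after `j` queries. -/
def state (A : Circuit) {N : ℕ} (x : Fin N → Bool) : ℕ → A.ι → ℂ
  | 0 => (A.U 0 : Matrix A.ι A.ι ℂ) *ᵥ ket A.start
  | j + 1 => (A.U (j + 1) : Matrix A.ι A.ι ℂ) *ᵥ (oracle A.idx x *ᵥ A.state x j)

/-- The circuit takes the start state to the basis state of the correct answer, for every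
ordered input of length `N`. -/
def SearchesExactly (A : Circuit) (N : ℕ) : Prop :=
  Set.InjOn A.ans (Set.Iio N) ∧
    ∀ x ∈ orderedInputs N, A.state x A.queries = ket (A.ans (leftmostOne x))

end Circuit

/-- The black box algorithm `B` carries out the circuit `A`, for inputs of length `N`:
after relabelling the basis states (by a labelling `e t` that may depend on the time `t`, such
as one that uses a clock in the `z` register), each application of its single operator
`U` acts as the next operator of the circuit, the indices in the index register agree before
each query (all indices `≥ N` being equivalent), and at the end the `⌈log₂ N⌉` rightmost bits
of the label of the answer `k` are `k`. -/
def BlackBoxAlgorithm.Implements (B : BlackBoxAlgorithm) (N : ℕ) (A : Circuit) : Prop :=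
  B.T = A.queries ∧ ∃ e : ℕ → A.ι → B.Basis,
    (∀ t ≤ B.T + 1, Function.Injective (e t)) ∧
    e 0 A.start = (0, 0) ∧
    (∀ t ≤ B.T, ∀ b, (B.U : Matrix B.Basis B.Basis ℂ) *ᵥ ket (e t b) =
      ∑ b', (A.U t : Matrix A.ι A.ι ℂ) b' b • ket (e (t + 1) b')) ∧
    (∀ t, 1 ≤ t → t ≤ B.T → ∀ b, min ((e t b).2 : ℕ) N = min (A.idx b) N) ∧
    (∀ k < N, ((e (B.T + 1) (A.ans k)).2 : ℕ) % 2 ^ Nat.clog 2 N = k)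

/-! ### Pebbled binary trees -/

/-- Binary trees whose internal vertices carry pebbles with colors in `C` (at most one of each
color per vertex). -/
inductive PebbledTree (C : Type) : Type where
  | leaf : PebbledTree C
  | node (pebbles : Finset C) (left right : PebbledTree C) : PebbledTree C

namespace PebbledTree

variable {C : Type}

/-- Vertices and leaves are addressed by the path from the root: `false` is a step to the left
child and `true` a step to the right child.  The addresses of the leaves, from left to right. -/
def leafAddrs : PebbledTree C → List (List Bool)
  | leaf => [[]]
  | node _ l r => l.leafAddrs.map (List.cons false) ++ r.leafAddrs.map (List.cons true)

/-- The addresses of the internal vertices, from left to right. -/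
def vertices : PebbledTree C → List (List Bool)
  | leaf => []
  | node _ l r => l.vertices.map (List.cons false) ++ [] :: r.vertices.map (List.cons true)

/-- The set of colors of the pebbles on a vertex. -/
def peb : PebbledTree C → List Bool → Finset C
  | leaf, _ => ∅
  | node p _ _, [] => p
  | node _ l _, false :: v => l.peb v
  | node _ _ r, true :: v => r.peb v

/-- The number of leaves; the leaves are labelled `0, 1, …` from left to right. -/
def numLeaves (t : PebbledTree C) : ℕ := t.leafAddrs.length

/-- The address of the leaf with label `ℓ`. -/
def leafAddr (t : PebbledTree C) (ℓ : ℕ) : List Bool := t.leafAddrs.getD ℓ []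

/-- The labels of the leaves in the subtree rooted at `u`. -/
def leavesBelow (t : PebbledTree C) (u : List Bool) : Finset ℕ :=
  (Finset.range t.numLeaves).filter fun ℓ => u <+: t.leafAddr ℓ

/-- The label of the rightmost leaf in the subtree rooted at `u`. -/
def rightmostLeaf (t : PebbledTree C) (u : List Bool) : ℕ := (t.leavesBelow u).sup id

/-- The number `p_v` of pebbles on a vertex. -/
def p (t : PebbledTree C) (v : List Bool) : ℕ := (t.peb v).card

/-- The total number of pebbles on the proper ancestors of a vertex. -/
def pAncestors (t : PebbledTree C) (v : List Bool) : ℕ :=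
  ∑ k ∈ Finset.range v.length, t.p (v.take k)

/-- There are no pebbles on the parent of `v` (in particular if `v` is the root). -/
def ParentBare (t : PebbledTree C) (v : List Bool) : Prop :=
  v = [] ∨ t.p v.dropLast = 0

/-- The vertices that carry a pebble of color `c`, from left to right. -/
def colorVertices [DecidableEq C] (t : PebbledTree C) (c : C) : List (List Bool) :=
  t.vertices.filter fun v => c ∈ t.peb v

/-- The pebbles form a fair and tight covering with at most `N'` pebbles of each color. -/
structure IsFairTightCovering [DecidableEq C] (t : PebbledTree C) (N' : ℕ) : Prop where
  /-- On every path from the root to a leaf there is exactly one pebble of each color. -/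
  one_per_path : ∀ a ∈ t.leafAddrs, ∀ c, ∃! k, k < a.length ∧ c ∈ t.peb (a.take k)
  /-- Every vertex has at least as many pebbles as its proper ancestors in total. -/
  ancestors_le : ∀ v ∈ t.vertices, t.pAncestors v ≤ t.p v
  /-- At most `N'` pebbles of each color are used. -/
  count_le : ∀ c, (t.colorVertices c).length ≤ N'
  /-- Every color is used equally often. -/
  fair : ∀ c c', (t.colorVertices c).length = (t.colorVertices c').length
  /-- A vertex has as many pebbles as its proper ancestors in total, or these have none. -/
  tight : ∀ v ∈ t.vertices, t.p v = t.pAncestors v ∨ t.pAncestors v = 0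

end PebbledTree

/-! ### One level of the recursion -/

/-- The number of leaves of the tree for inputs of length `N`: the least even number `≥ N`. -/
def treeSize (N : ℕ) : ℕ := N + N % 2

/-- The number of colors, `2 ^ s` with `s = ⌊log₄ (L / 2)⌋`, for a tree with `L` leaves. -/
def numColors (L : ℕ) : ℕ := 2 ^ Nat.log 4 (L / 2)

/-- The bound `N' = ⌊L / 3 + log₂ L⌋` on the number of pebbles of each color. -/
def pebbleBound (L : ℕ) : ℕ := ⌊(L : ℝ) / 3 + Real.logb 2 L⌋₊

/-- The size of the recursive search: the even one of `N'` and `N' + 1`. -/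
def recSize (N : ℕ) : ℕ := pebbleBound (treeSize N) + pebbleBound (treeSize N) % 2

/-- For a color `c`, the recursive search queries its `j`-th item at the rightmost leaf below
the `j`-th vertex that carries color `c`.  Items beyond the last vertex, and the leaf that pads
an input of odd length, stand for the last item `N - 1`. -/
def subIndex {C : Type} [DecidableEq C] (N : ℕ) (t : PebbledTree C) (c : C) (j : ℕ) : ℕ :=
  if h : j < (t.colorVertices c).length then
    min (t.rightmostLeaf ((t.colorVertices c)[j])) (N - 1)
  else N - 1

/-- The state `|Φ_u⟩`, the sum over the leaves `ℓ` below `u` of `2 ^ (-d(u,ℓ) / 2) |ℓ⟩`, where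
`leafState ℓ` is the basis state of the leaf `ℓ`. -/
def Phi {C ι : Type} [DecidableEq ι] (t : PebbledTree C) (leafState : ℕ → ι)
    (u : List Bool) : ι → ℂ :=
  ∑ ℓ ∈ t.leavesBelow u,
    (((√(2 ^ ((t.leafAddr ℓ).length - u.length)))⁻¹ : ℝ) : ℂ) • ket (leafState ℓ)

/-- The circuit `A`, for inputs of length `N`, is obtained from the circuit `A'`, for inputs of
length `M`, and the pebbled tree `t` by one level of the pebbling recursion.  All operators are
required to act as described on the states that matter, and are arbitrary elsewhere. -/
structure PebbleStep {C : Type} [Fintype C] [DecidableEq C] (N M : ℕ) (t : PebbledTree C)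
    (A' A : Circuit) where
  /-- `reg b c` is the state `|b⟩|c⟩`, for a basis state `b` of the recursive search. -/
  reg : A'.ι → C → A.ι
  reg_inj : ∀ b c b' c', reg b c = reg b' c' → b = b' ∧ c = c'
  reg_idx : ∀ b c, A'.idx b < M → A.idx (reg b c) = subIndex N t c (A'.idx b)
  reg_idx' : ∀ b c, M ≤ A'.idx b → N ≤ A.idx (reg b c)
  /-- `vtx v` is the state `|v⟩|0⟩` of a vertex `v`. -/
  vtx : List Bool → A.ι
  vtx_inj : Set.InjOn vtx {v | 0 < t.p v}
  /-- `vtxBit v β` is the state `|v; β⟩`. -/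
  vtxBit : List Bool → Bool → A.ι
  vtxBit_inj : ∀ v v' β β', 0 < t.p v → 0 < t.p v' → vtxBit v β = vtxBit v' β' →
    v = v' ∧ β = β'
  /-- `leafState ℓ` is the state of the leaf with label `ℓ`. -/
  leafState : ℕ → A.ι
  leafState_inj : Set.InjOn leafState (Set.Iio t.numLeaves)
  ans_eq : ∀ k < N, A.ans k = leafState k
  /-- `prep` sets up the uniform superposition of the colors. -/
  prep : Matrix.unitaryGroup A.ι ℂ
  prep_spec : (prep : Matrix A.ι A.ι ℂ) *ᵥ ket A.start =
    (((√(Fintype.card C))⁻¹ : ℝ) : ℂ) • ∑ c, ket (reg A'.start c)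
  /-- `lift j` applies the `j`-th operator of the recursive search for all colors in
  parallel. -/
  lift : ℕ → Matrix.unitaryGroup A.ι ℂ
  lift_spec : ∀ j ≤ A'.queries, ∀ b c, (lift j : Matrix A.ι A.ι ℂ) *ᵥ ket (reg b c) =
    ∑ b', (A'.U j : Matrix A'.ι A'.ι ℂ) b' b • ket (reg b' c)
  /-- The coloring operator; the state `|v⟩|c⟩`, for a vertex `v` with color `c`, is the state
  in which the recursive search for color `c` has found the vertex `v`. -/
  U₁ : Matrix.unitaryGroup A.ι ℂ
  U₁_spec : ∀ v, 0 < t.p v → (U₁ : Matrix A.ι A.ι ℂ) *ᵥ ket (vtx v) =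
    (((√(t.p v))⁻¹ : ℝ) : ℂ) •
      ∑ c ∈ t.peb v, ket (reg (A'.ans ((t.colorVertices c).idxOf v)) c)
  /-- The query operator `O'_x` is realised by a query between two fixed operators. -/
  qPre : Matrix.unitaryGroup A.ι ℂ
  qPost : Matrix.unitaryGroup A.ι ℂ
  query_bare : ∀ (x : Fin N → Bool) (v : List Bool), 0 < t.p v → t.ParentBare v →
    ((qPost : Matrix A.ι A.ι ℂ) * oracle A.idx x * (qPre : Matrix A.ι A.ι ℂ)) *ᵥ ket (vtx v) =
      ket (vtxBit v (bit x (t.rightmostLeaf (v ++ [false]))))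
  query_pebbled : ∀ (x : Fin N → Bool) (v : List Bool), 0 < t.p v → ¬ t.ParentBare v →
    ((qPost : Matrix A.ι A.ι ℂ) * oracle A.idx x * (qPre : Matrix A.ι A.ι ℂ)) *ᵥ ket (vtx v) =
      phase x (t.rightmostLeaf (v ++ [false])) • ket (vtx v)
  /-- The operator that maps vertices to superpositions of the leaves below them. -/
  U₂ : Matrix.unitaryGroup A.ι ℂ
  U₂_bare_zero : ∀ v, 0 < t.p v → t.ParentBare v →
    (U₂ : Matrix A.ι A.ι ℂ) *ᵥ ket (vtxBit v false) = Phi t leafState (v ++ [true])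
  U₂_bare_one : ∀ v, 0 < t.p v → t.ParentBare v →
    (U₂ : Matrix A.ι A.ι ℂ) *ᵥ ket (vtxBit v true) = Phi t leafState (v ++ [false])
  U₂_pebbled : ∀ v, 0 < t.p v → ¬ t.ParentBare v →
    (U₂ : Matrix A.ι A.ι ℂ) *ᵥ ket (vtx v) =
      (((√2)⁻¹ : ℝ) : ℂ) • (Phi t leafState (v ++ [true]) - Phi t leafState (v ++ [false]))
  /-- The circuit makes the queries of the recursive search and one more, and its operators
  between the queries are composed of those above. -/
  queries_eq : A.queries = A'.queries + 1
  U_eq : ∀ j ≤ A'.queries,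
    A.U j = (if j = A'.queries then qPre * U₁⁻¹ else 1) * lift j * (if j = 0 then prep else 1)
  U_last : A.U (A'.queries + 1) = U₂ * qPost

/-- The circuits for inputs of length `N` that the recursive pebbling search produces.
For `N ≤ 8` the search is done by any exact circuit with at most three queries (the number that
binary search needs). -/
inductive IsPebbleSearch : ℕ → Circuit → Prop where
  | base (N : ℕ) (A : Circuit) (hN : 1 ≤ N) (hN' : N ≤ 8) (hA : A.SearchesExactly N)
      (hq : A.queries ≤ 3) : IsPebbleSearch N A
  | step (N : ℕ) (hN : 8 < N) (t : PebbledTree (Fin (numColors (treeSize N))))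
      (ht : t.numLeaves = treeSize N) (hc : t.IsFairTightCovering (pebbleBound (treeSize N)))
      (A' A : Circuit) (hA' : IsPebbleSearch (recSize N) A')
      (hA : PebbleStep N (recSize N) t A' A) : IsPebbleSearch N A

/-- The recursive pebbling search for inputs of length `N`, as an algorithm in the black box
model. -/
def IsPebbleSearchAlgorithm (N : ℕ) (B : BlackBoxAlgorithm) : Prop :=
  ∃ A : Circuit, IsPebbleSearch N A ∧ B.Implements N A

end OrderedSearch

end

open scoped Matrix

noncomputable section

namespace OrderedSearch

/-! ### Orthonormal families and unitary extensions -/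

/-! One level of the recursion is exact because amplitudes telescope along the path from the root to
the leaf f(x). Each color has exactly one pebble on this path, and the items queried for a color c
form a sorted list whose answer is the position of the path vertex of color c (`subInput_spec`). The
parallel searches therefore end in a uniform superposition over all colors, and undoing the coloring
groups it by vertices into the sum of √p_v |v⟩ over the path, up to normalization
(`U₁_mulVec_path`). The bit at the rightmost leaf of the left subtree of v tells which child w is
next on the path. The last query and `U₂` send a pebbled v to Φ_w if nothing above v is pebbled, and
to √2 Φ_w - Φ_v otherwise (`query_vtx`). Let P be the number of pebbles above v. Since P = 0 or p_v
= P, in either case √P Φ_v plus √p_v times the image of v is √(P + p_v) Φ_w. At the leaf all colors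
have been met and the state is |f(x)⟩.

The algorithm exists because any map between orthonormal families extends to a unitary
(`exists_unitary_map`). The delicate family is the image of `U₂` (`orthonormalFamily_lastState`). A
clock merges the operators of a circuit into a single one (`exists_implements`). For the coverings,
put pebbles on complete trees so that every level doubles the number of colors met. One such tree is
not fair, but its 2^m color rotations together are: they have 2·4^m leaves and (1 + 2·4^m)/3 pebbles
of each color. The base 4 digits of L/2 say how many of these forests to join, and each digit costs
at most one pebble more than a third of its leaves (`exists_hasFairForest`).

For the query count, each level costs one query and shrinks N to about N/3 + log₂ N. The bound 3^k +
3k + 12 on the size is inherited with k - 1 in place of k (`recSize_le_of_le`), so about log₃ N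
levels lead to bounded size. -/

/-- An orthonormal family of vectors in `ι → ℂ`. -/
def OrthonormalFamily {ι κ : Type} [Fintype ι] (f : κ → ι → ℂ) : Prop :=
  (∀ a, star (f a) ⬝ᵥ f a = 1) ∧ ∀ a b, a ≠ b → star (f a) ⬝ᵥ f b = 0

section Unitary

variable {ι κ : Type}

theorem ket_apply [DecidableEq ι] (b c : ι) : ket b c = if c = b then (1 : ℂ) else 0 := by
  simp [ket, Pi.single_apply]

/-- The Hadamard matrix. -/
def hadamard : Matrix.unitaryGroup Bool ℂ :=
  ⟨Matrix.of fun β σ => if β && σ then -(((√2)⁻¹ : ℝ) : ℂ) else (((√2)⁻¹ : ℝ) : ℂ), by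
    have h : (((√2)⁻¹ : ℝ) : ℂ) * (((√2)⁻¹ : ℝ) : ℂ) = 2⁻¹ := by
      rw [← Complex.ofReal_mul, ← mul_inv, Real.mul_self_sqrt (by norm_num)]
      norm_num
    rw [Matrix.mem_unitaryGroup_iff']
    ext β σ
    rw [Matrix.mul_apply, Fintype.sum_bool]
    simp only [Matrix.star_apply]
    cases β <;> cases σ <;>
      simp [-Complex.ofReal_inv, Complex.conj_ofReal, h] <;> norm_num⟩

/-- The states `(|e₀⟩ ± |e₁⟩) / √2`. -/
def plusMinus [DecidableEq ι] (e : Bool → ι) (σ : Bool) : ι → ℂ :=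
  (((√2)⁻¹ : ℝ) : ℂ) • (ket (e false) + (if σ then -1 else 1 : ℂ) • ket (e true))

/-- Seen as embedded columns of a unitary matrix, these states inherit orthonormality from
`orthonormalFamily_columns`. -/
theorem sum_hadamard_smul_ket [DecidableEq ι] (e : Bool → ι) (σ : Bool) :
    ∑ b', (hadamard : Matrix Bool Bool ℂ) b' σ • ket (e b') = plusMinus e σ := by
  rw [Fintype.sum_bool, plusMinus]
  cases σ <;> simp [hadamard, add_comm, -Complex.ofReal_inv]

variable [Fintype ι]

theorem OrthonormalFamily.orthonormal {f : κ → ι → ℂ} (hf : OrthonormalFamily f) :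
    Orthonormal ℂ (fun a => (WithLp.toLp 2 (f a) : EuclideanSpace ℂ ι)) := by
  classical
  rw [orthonormal_iff_ite]
  intro a b
  rw [EuclideanSpace.inner_toLp_toLp, dotProduct_comm]
  split_ifs with h
  · subst h; exact hf.1 a
  · exact hf.2 a b h

theorem OrthonormalFamily.comp {κ' : Type} {f : κ → ι → ℂ} (hf : OrthonormalFamily f)
    {e : κ' → κ} (he : Function.Injective e) : OrthonormalFamily fun a => f (e a) :=
  ⟨fun a => hf.1 (e a), fun _ _ h => hf.2 _ _ fun h' => h (he h')⟩

variable [DecidableEq ι]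

/-- Every map between orthonormal families extends to a unitary operator. -/
theorem exists_unitary_map {f g : κ → ι → ℂ} (hf : OrthonormalFamily f)
    (hg : OrthonormalFamily g) :
    ∃ U : Matrix.unitaryGroup ι ℂ, ∀ a, (U : Matrix ι ι ℂ) *ᵥ f a = g a := by
  classical
  let F : κ → EuclideanSpace ℂ ι := fun a => WithLp.toLp 2 (f a)
  let G : κ → EuclideanSpace ℂ ι := fun a => WithLp.toLp 2 (g a)
  have hF : Orthonormal ℂ F := hf.orthonormal
  have hG : Orthonormal ℂ G := hg.orthonormal
  let b := Module.Basis.span hF.linearIndependent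
  have hb : ∀ a, ((b a : Submodule.span ℂ (Set.range F)) : EuclideanSpace ℂ ι) = F a :=
    fun a => congrArg Subtype.val (Module.Basis.span_apply hF.linearIndependent a)
  have hbo : Orthonormal ℂ b := by
    rw [orthonormal_iff_ite]
    intro i j
    rw [Submodule.coe_inner, hb, hb]
    exact orthonormal_iff_ite.1 hF i j
  let L0 := b.constr ℂ G
  have hL0 : ∀ a, L0 (b a) = G a := fun a => b.constr_basis ℂ G a
  have hLo : Orthonormal ℂ (L0 ∘ b) := by
    have : L0 ∘ b = G := funext hL0
    rw [this]; exact hG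
  let L := (L0.isometryOfOrthonormal hbo hLo).extend
  have hL : ∀ a, L (F a) = G a := by
    intro a
    rw [← hb a, LinearIsometry.extend_apply]
    exact hL0 a
  let A : Matrix ι ι ℂ := fun i j => L (EuclideanSpace.single j 1) i
  have hA : ∀ x : ι → ℂ, A *ᵥ x = WithLp.ofLp (L (WithLp.toLp 2 x)) := by
    intro x
    have : (WithLp.toLp 2 x : EuclideanSpace ℂ ι)
        = ∑ j, x j • EuclideanSpace.single j (1 : ℂ) := by
      ext i
      simp [Finset.sum_apply, Pi.single_apply]
    rw [this, map_sum]
    ext i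
    simp [A, Matrix.mulVec, dotProduct, mul_comm]
  have hAu : A ∈ Matrix.unitaryGroup ι ℂ := by
    rw [Matrix.mem_unitaryGroup_iff']
    ext i j
    have h1 : inner ℂ (L (EuclideanSpace.single i (1 : ℂ))) (L (EuclideanSpace.single j (1 : ℂ)))
        = if i = j then (1 : ℂ) else 0 := by
      rw [LinearIsometry.inner_map_map]
      simp [EuclideanSpace.inner_single_left]
    rw [Matrix.one_apply, ← h1, PiLp.inner_apply]
    rw [Matrix.mul_apply]
    exact Finset.sum_congr rfl fun k _ => mul_comm _ _
  refine ⟨⟨A, hAu⟩, fun a => ?_⟩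
  change A *ᵥ f a = g a
  rw [hA]
  exact congrArg WithLp.ofLp (hL a)

theorem star_ket_dotProduct (b : ι) (v : ι → ℂ) : star (ket b) ⬝ᵥ v = v b := by
  simp [dotProduct, ket_apply]

theorem orthonormalFamily_ket {e : κ → ι} (he : Function.Injective e) :
    OrthonormalFamily fun a => ket (e a) := by
  refine ⟨fun a => ?_, fun a b h => ?_⟩
  · exact (star_ket_dotProduct _ _).trans (by simp [ket_apply])
  · refine (star_ket_dotProduct _ _).trans ?_
    simp only [ket_apply]
    rw [if_neg fun h' => h (he h')]

theorem mulVec_ket_apply (A : Matrix ι ι ℂ) (b i : ι) : (A *ᵥ ket b) i = A i b := by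
  simp [ket]

theorem oracle_mulVec_ket {N : ℕ} (idx : ι → ℕ) (x : Fin N → Bool) (b : ι) :
    oracle idx x *ᵥ ket b = phase x (idx b) • ket b := by
  ext i
  rw [mulVec_ket_apply, Pi.smul_apply, ket_apply, oracle, Matrix.diagonal_apply]
  split_ifs with h
  · subst h; simp
  · simp

theorem oracle_mulVec_apply {N : ℕ} (idx : ι → ℕ) (x : Fin N → Bool) (ψ : ι → ℂ) (b : ι) :
    (oracle idx x *ᵥ ψ) b = phase x (idx b) * ψ b := by
  rw [oracle, Matrix.mulVec_diagonal]

theorem unitary_inv_mulVec (U : Matrix.unitaryGroup ι ℂ) {v w : ι → ℂ}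
    (h : (U : Matrix ι ι ℂ) *ᵥ v = w) :
    ((U⁻¹ : Matrix.unitaryGroup ι ℂ) : Matrix ι ι ℂ) *ᵥ w = v := by
  rw [← h, Matrix.mulVec_mulVec, ← Submonoid.coe_mul, inv_mul_cancel, Submonoid.coe_one,
    Matrix.one_mulVec]

/-- The columns of a unitary matrix, embedded along injective maps with disjoint ranges, are
orthonormal. -/
theorem orthonormalFamily_columns {κ' : Type} [Fintype κ] [DecidableEq κ] [DecidableEq κ']
    (U : κ' → Matrix.unitaryGroup κ ℂ) (e : κ → κ' → ι)
    (he : ∀ b c b' c', e b c = e b' c' → b = b' ∧ c = c') :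
    OrthonormalFamily fun q : κ × κ' =>
      ∑ b', (U q.2 : Matrix κ κ ℂ) b' q.1 • ket (e b' q.2) := by
  have key : ∀ q r : κ × κ', star (∑ b', (U q.2 : Matrix κ κ ℂ) b' q.1 • ket (e b' q.2)) ⬝ᵥ
      (∑ b', (U r.2 : Matrix κ κ ℂ) b' r.1 • ket (e b' r.2)) =
      if q = r then 1 else 0 := by
    rintro ⟨b, c⟩ ⟨b', c'⟩
    simp only [star_sum, sum_dotProduct, dotProduct_sum, star_smul, smul_dotProduct,
      dotProduct_smul, star_ket_dotProduct, ket_apply, smul_eq_mul, mul_ite, mul_one, mul_zero]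
    by_cases hc : c = c'
    · subst hc
      have h2 := congrFun (congrFun (Matrix.mem_unitaryGroup_iff'.1 (U c).2) b) b'
      rw [Matrix.mul_apply, Matrix.one_apply] at h2
      simp only [Prod.mk.injEq, and_true]
      rw [← h2]
      refine Finset.sum_congr rfl fun i _ => ?_
      rw [Finset.sum_eq_single i]
      · simp [Matrix.star_apply, mul_comm]
      · intro j _ hj
        rw [if_neg]
        exact fun h => hj (he _ _ _ _ h).1
      · simp
    · rw [if_neg (by simp [hc])]
      refine Finset.sum_eq_zero fun i _ => mul_eq_zero_of_right _ (Finset.sum_eq_zero fun j _ => ?_)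
      rw [if_neg]
      exact fun h => hc (he _ _ _ _ h).2
  exact ⟨fun q => by rw [key, if_pos rfl], fun q r h => by rw [key, if_neg h]⟩

theorem orthonormalFamily_plusMinus [DecidableEq κ] {e : κ → Bool → ι}
    (he : ∀ a β a' β', e a β = e a' β' → a = a' ∧ β = β') :
    OrthonormalFamily fun r : κ × Bool => plusMinus (e r.1) r.2 := by
  have h := (orthonormalFamily_columns (fun _ : κ => hadamard) (fun β a => e a β)
    fun β a β' a' h => (he _ _ _ _ h).symm).comp (e := fun r : κ × Bool => (r.2, r.1))
      fun r r' h => Prod.ext (Prod.ext_iff.1 h).2 (Prod.ext_iff.1 h).1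
  simpa only [sum_hadamard_smul_ket] using h

/-- Uniform superpositions of disjoint sets of basis states are orthonormal. -/
theorem orthonormalFamily_uniform {γ : Type} {S : κ → Finset γ} {e : κ → γ → ι}
    (hS : ∀ a, (S a).Nonempty)
    (he : ∀ a b, ∀ c ∈ S a, ∀ d ∈ S b, e a c = e b d → a = b ∧ c = d) :
    OrthonormalFamily fun a => (((√((S a).card : ℝ))⁻¹ : ℝ) : ℂ) • ∑ c ∈ S a, ket (e a c) := by
  classical
  refine ⟨fun a => ?_, fun a b hab => ?_⟩
  · have hpos : (0 : ℝ) < (S a).card := Nat.cast_pos.2 (hS a).card_pos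
    have h1 : ∀ c ∈ S a, ∑ d ∈ S a, star (ket (e a c) : ι → ℂ) ⬝ᵥ ket (e a d) = 1 := by
      intro c hc
      rw [Finset.sum_eq_single c]
      · simp [star_ket_dotProduct, ket_apply]
      · intro d hd hdc
        rw [star_ket_dotProduct, ket_apply, if_neg]
        exact fun h => hdc (he _ _ _ hc _ hd h).2.symm
      · exact fun h => absurd hc h
    rw [star_smul, smul_dotProduct, dotProduct_smul, star_sum, sum_dotProduct,
      Finset.sum_congr rfl fun c hc => (dotProduct_sum _ _ _).trans (h1 c hc), Finset.sum_const,
      nsmul_eq_mul, mul_one, Complex.star_def, Complex.conj_ofReal, smul_eq_mul, smul_eq_mul,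
      ← Complex.ofReal_natCast, ← Complex.ofReal_mul, ← Complex.ofReal_mul, ← mul_assoc,
      ← mul_inv, Real.mul_self_sqrt hpos.le, inv_mul_cancel₀ hpos.ne', Complex.ofReal_one]
  · rw [star_smul, smul_dotProduct, dotProduct_smul, star_sum, sum_dotProduct,
      Finset.sum_eq_zero, smul_zero, smul_zero]
    intro c hc
    rw [dotProduct_sum]
    refine Finset.sum_eq_zero fun d hd => ?_
    rw [star_ket_dotProduct, ket_apply, if_neg]
    exact fun h => hab (he _ _ _ hd _ hc h.symm).1.symm

/-- Phase kickback: an index `≥ N` leaves the `false` branch untouched, so the phase of the `true`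
branch becomes a relative sign that a Hadamard operator can read as a bit. -/
theorem oracle_mulVec_plusMinus {N : ℕ} (idx : ι → ℕ) (x : Fin N → Bool) (e : Bool → ι)
    (h : N ≤ idx (e false)) :
    oracle idx x *ᵥ plusMinus e false = plusMinus e (bit x (idx (e true))) := by
  rw [plusMinus, plusMinus, Matrix.mulVec_smul, Matrix.mulVec_add, Matrix.mulVec_smul,
    oracle_mulVec_ket, oracle_mulVec_ket, phase, phase]
  have : bit x (idx (e false)) = false := dif_neg (not_lt.2 h)
  simp [this]

end Unitary

/-! ### Addresses in binary trees -/

/-- The address `u` branches off to the left of the address `w`. -/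
def LeftOf : List Bool → List Bool → Prop
  | false :: _, true :: _ => True
  | false :: u, false :: w => LeftOf u w
  | true :: u, true :: w => LeftOf u w
  | _, _ => False

theorem leftOf_cons (β : Bool) (u w : List Bool) : LeftOf (β :: u) (β :: w) ↔ LeftOf u w := by
  cases β <;> simp [LeftOf]

theorem LeftOf.asymm : ∀ {u w : List Bool}, LeftOf u w → ¬ LeftOf w u
  | [], _ => by simp [LeftOf]
  | _ :: _, [] => by simp [LeftOf]
  | false :: u, true :: w => by simp [LeftOf]
  | true :: u, false :: w => by simp [LeftOf]
  | false :: u, false :: w => by simpa [LeftOf] using LeftOf.asymm (u := u) (w := w)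
  | true :: u, true :: w => by simpa [LeftOf] using LeftOf.asymm (u := u) (w := w)

theorem LeftOf.irrefl (u : List Bool) : ¬ LeftOf u u := fun h => h.asymm h

theorem LeftOf.of_prefix : ∀ {u w a b : List Bool}, LeftOf u w → u <+: a → w <+: b → LeftOf a b
  | [], _, _, _ => by simp [LeftOf]
  | _ :: _, [], _, _ => by simp [LeftOf]
  | x :: u, y :: w, a, b => by
    rintro h ⟨a', rfl⟩ ⟨b', rfl⟩
    cases x <;> cases y <;> simp [LeftOf] at h ⊢ <;>
      exact h.of_prefix (List.prefix_append _ _) (List.prefix_append _ _)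

theorem LeftOf.not_prefix {u w a : List Bool} (h : LeftOf u w) (hu : u <+: a) : ¬ w <+: a :=
  fun hw => LeftOf.irrefl a (h.of_prefix hu hw)

theorem prefix_or_leftOf : ∀ u w : List Bool, u <+: w ∨ w <+: u ∨ LeftOf u w ∨ LeftOf w u
  | [], _ => Or.inl List.nil_prefix
  | _ :: _, [] => Or.inr (Or.inl List.nil_prefix)
  | false :: u, true :: w => by simp [LeftOf]
  | true :: u, false :: w => by simp [LeftOf]
  | false :: u, false :: w => by simpa [LeftOf] using prefix_or_leftOf u w
  | true :: u, true :: w => by simpa [LeftOf] using prefix_or_leftOf u w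

theorem leftOf_children (v : List Bool) : LeftOf (v ++ [false]) (v ++ [true]) := by
  induction v with
  | nil => simp [LeftOf]
  | cons β v ih => simpa only [List.cons_append, leftOf_cons] using ih

theorem exists_child_prefix {v w : List Bool} (h : v <+: w) (hne : v ≠ w) :
    ∃ β, v ++ [β] <+: w := by
  obtain ⟨_ | ⟨β, s⟩, rfl⟩ := h
  · simp at hne
  · exact ⟨β, s, by simp⟩

namespace PebbledTree

variable {C : Type}

theorem leafAddrs_pairwise (t : PebbledTree C) : t.leafAddrs.Pairwise LeftOf := by
  induction t with
  | leaf => simp [leafAddrs]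
  | node _ l r hl hr =>
    simp only [leafAddrs, List.pairwise_append, List.pairwise_map, leftOf_cons]
    refine ⟨hl, hr, ?_⟩
    simp +contextual [LeftOf]

/-- In-order traversal visits incomparable vertices from left to right. Comparable ones may come in
either order, and the covering condition later excludes them within one color. -/
theorem vertices_pairwise (t : PebbledTree C) :
    t.vertices.Pairwise fun u w => LeftOf u w ∨ u <+: w ∨ w <+: u := by
  induction t with
  | leaf => simp [vertices]
  | node _ l r hl hr =>
    simp only [vertices, List.pairwise_append, List.pairwise_map, List.pairwise_cons, leftOf_cons,
      List.cons_prefix_cons, true_and]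
    refine ⟨hl, ⟨fun _ _ => by simp, hr⟩, ?_⟩
    intro a ha b hb
    obtain ⟨a, _, rfl⟩ := List.mem_map.1 ha
    rcases List.mem_cons.1 hb with rfl | hb
    · simp
    · obtain ⟨b, _, rfl⟩ := List.mem_map.1 hb
      simp [LeftOf]

/-- `w` is the address of a vertex or a leaf. -/
def IsAddr (t : PebbledTree C) (w : List Bool) : Prop := ∃ a ∈ t.leafAddrs, w <+: a

theorem isAddr_of_mem_leafAddrs {t : PebbledTree C} {a : List Bool} (h : a ∈ t.leafAddrs) :
    t.IsAddr a := ⟨a, h, List.prefix_rfl⟩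

theorem isAddr_nil (t : PebbledTree C) : t.IsAddr [] := by
  have : t.leafAddrs ≠ [] := by
    induction t with
    | leaf => simp [leafAddrs]
    | node _ l r hl hr => simp [leafAddrs, hl]
  obtain ⟨a, ha⟩ := List.exists_mem_of_ne_nil _ this
  exact ⟨a, ha, List.nil_prefix⟩

theorem isAddr_node_false {P : Finset C} {l r : PebbledTree C} {w : List Bool} :
    (node P l r).IsAddr (false :: w) ↔ l.IsAddr w := by
  simp [IsAddr, leafAddrs, or_and_right, exists_or]

theorem isAddr_node_true {P : Finset C} {l r : PebbledTree C} {w : List Bool} :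
    (node P l r).IsAddr (true :: w) ↔ r.IsAddr w := by
  simp [IsAddr, leafAddrs, or_and_right, exists_or]

theorem isAddr_leaf {w : List Bool} : (leaf : PebbledTree C).IsAddr w ↔ w = [] := by
  simp [IsAddr, leafAddrs]

/-- This characterizes internal vertices as the addresses with a child, so that most later facts
about vertices follow from prefixes of leaf addresses without an induction on the tree. -/
theorem isAddr_child_iff (t : PebbledTree C) (v : List Bool) (β : Bool) :
    t.IsAddr (v ++ [β]) ↔ v ∈ t.vertices := by
  induction t generalizing v with
  | leaf => simp [isAddr_leaf, vertices]
  | node P l r hl hr =>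
    rcases v with _ | ⟨_ | _, v⟩
    · cases β <;> simp [isAddr_node_false, isAddr_node_true, vertices, isAddr_nil]
    · simp [isAddr_node_false, vertices, hl]
    · simp [isAddr_node_true, vertices, hr]

theorem IsAddr.of_prefix {t : PebbledTree C} {v w : List Bool} (h : t.IsAddr w) (hv : v <+: w) :
    t.IsAddr v := by
  obtain ⟨a, ha, hw⟩ := h
  exact ⟨a, ha, hv.trans hw⟩

theorem isAddr_of_mem_vertices {t : PebbledTree C} {v : List Bool} (h : v ∈ t.vertices) :
    t.IsAddr v :=
  ((isAddr_child_iff t v false).2 h).of_prefix (List.prefix_append _ _)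

theorem mem_vertices_of_prefix {t : PebbledTree C} {v w : List Bool} (h : t.IsAddr w)
    (hv : v <+: w) (hne : v ≠ w) : v ∈ t.vertices := by
  obtain ⟨β, hβ⟩ := exists_child_prefix hv hne
  exact (isAddr_child_iff t v β).1 (h.of_prefix hβ)

theorem take_mem_vertices {t : PebbledTree C} {a : List Bool} (h : t.IsAddr a) {k : ℕ}
    (hk : k < a.length) : a.take k ∈ t.vertices := by
  refine mem_vertices_of_prefix h (List.take_prefix k a) fun h' => ?_
  have := congrArg List.length h'
  rw [List.length_take] at this
  omega

theorem mem_vertices_of_mem_peb {t : PebbledTree C} {v : List Bool} {c : C} (h : c ∈ t.peb v) :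
    v ∈ t.vertices := by
  induction t generalizing v with
  | leaf => simp [peb] at h
  | node P l r hl hr =>
    rcases v with _ | ⟨_ | _, v⟩
    · simp [vertices]
    · simpa [vertices] using hl h
    · simpa [vertices] using hr h

theorem mem_vertices_of_p_pos {t : PebbledTree C} {v : List Bool} (h : 0 < t.p v) :
    v ∈ t.vertices := by
  obtain ⟨c, hc⟩ := Finset.card_pos.1 h
  exact mem_vertices_of_mem_peb hc

theorem eq_of_prefix_of_mem_leafAddrs {t : PebbledTree C} {a b : List Bool}
    (ha : a ∈ t.leafAddrs) (hb : t.IsAddr b) (h : a <+: b) : a = b := by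
  by_contra hne
  have hv := mem_vertices_of_prefix hb h hne
  clear h hne hb
  induction t generalizing a with
  | leaf => simp [vertices] at hv
  | node P l r hl hr =>
    rcases a with _ | ⟨_ | _, a⟩
    · simp [leafAddrs] at ha
    · exact hl (by simpa [leafAddrs] using ha) (by simpa [vertices] using hv)
    · exact hr (by simpa [leafAddrs] using ha) (by simpa [vertices] using hv)

theorem leafAddr_eq_getElem (t : PebbledTree C) {ℓ : ℕ} (h : ℓ < t.numLeaves) :
    t.leafAddr ℓ = t.leafAddrs[ℓ]'h := by
  simp only [leafAddr]
  exact List.getD_eq_getElem _ _ h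

theorem leafAddr_mem (t : PebbledTree C) {ℓ : ℕ} (h : ℓ < t.numLeaves) :
    t.leafAddr ℓ ∈ t.leafAddrs := by
  rw [leafAddr_eq_getElem t h]
  exact List.getElem_mem _

theorem exists_leafAddr_eq {t : PebbledTree C} {a : List Bool} (h : a ∈ t.leafAddrs) :
    ∃ ℓ, ℓ < t.numLeaves ∧ t.leafAddr ℓ = a := by
  obtain ⟨ℓ, hℓ, rfl⟩ := List.getElem_of_mem h
  exact ⟨ℓ, hℓ, leafAddr_eq_getElem t hℓ⟩

theorem leafAddr_leftOf (t : PebbledTree C) {ℓ ℓ' : ℕ} (h : ℓ < ℓ') (h' : ℓ' < t.numLeaves) :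
    LeftOf (t.leafAddr ℓ) (t.leafAddr ℓ') := by
  rw [leafAddr_eq_getElem t h', leafAddr_eq_getElem t (h.trans h')]
  exact List.pairwise_iff_getElem.1 t.leafAddrs_pairwise ℓ ℓ' (h.trans h') h' h

theorem mem_leavesBelow {t : PebbledTree C} {u : List Bool} {ℓ : ℕ} :
    ℓ ∈ t.leavesBelow u ↔ ℓ < t.numLeaves ∧ u <+: t.leafAddr ℓ := by
  simp [leavesBelow]

theorem lt_of_leftOf {t : PebbledTree C} {u w : List Bool} (h : LeftOf u w) {ℓ ℓ' : ℕ}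
    (hℓ : ℓ ∈ t.leavesBelow u) (hℓ' : ℓ' ∈ t.leavesBelow w) : ℓ < ℓ' := by
  rw [mem_leavesBelow] at hℓ hℓ'
  have h1 := h.of_prefix hℓ.2 hℓ'.2
  by_contra hle
  rcases (not_lt.1 hle).eq_or_lt with rfl | hlt
  · exact LeftOf.irrefl _ h1
  · exact h1.asymm (leafAddr_leftOf t hlt hℓ.1)

theorem le_rightmostLeaf {t : PebbledTree C} {u : List Bool} {ℓ : ℕ}
    (h : ℓ ∈ t.leavesBelow u) : ℓ ≤ t.rightmostLeaf u :=
  Finset.le_sup (f := id) h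

theorem leavesBelow_nonempty {t : PebbledTree C} {u : List Bool} (h : t.IsAddr u) :
    (t.leavesBelow u).Nonempty := by
  obtain ⟨a, ha, hu⟩ := h
  obtain ⟨ℓ, hℓ, rfl⟩ := exists_leafAddr_eq ha
  exact ⟨ℓ, mem_leavesBelow.2 ⟨hℓ, hu⟩⟩

theorem rightmostLeaf_mem {t : PebbledTree C} {u : List Bool} (h : t.IsAddr u) :
    t.rightmostLeaf u ∈ t.leavesBelow u := by
  obtain ⟨ℓ, hℓ, h'⟩ := Finset.exists_mem_eq_sup _ (leavesBelow_nonempty h) id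
  rw [rightmostLeaf, h']
  exact hℓ

/-! ### The states `Φ` -/

/-- The leaves below an address, weighted by powers of `1/2`, have total weight one. -/
theorem sum_leaf_weights {t : PebbledTree C} {w : List Bool} (h : t.IsAddr w) :
    (t.leafAddrs.map fun a => if w <+: a then ((2 : ℝ) ^ (a.length - w.length))⁻¹ else 0).sum
      = 1 := by
  induction t generalizing w with
  | leaf =>
    rw [isAddr_leaf] at h
    subst h
    simp [leafAddrs]
  | node P l r hl hr =>
    rcases w with _ | ⟨_ | _, w⟩
    · have h1 := hl (isAddr_nil l)
      have h2 := hr (isAddr_nil r)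
      simp only [List.nil_prefix, if_true, List.length_nil, Nat.sub_zero] at h1 h2
      simp only [leafAddrs, List.map_append, List.map_map, List.sum_append, Function.comp_def,
        List.nil_prefix, if_true, List.length_nil, Nat.sub_zero, List.length_cons, pow_succ,
        mul_inv, List.sum_map_mul_right, h1, h2]
      norm_num
    · simpa [leafAddrs, Function.comp_def] using hl (isAddr_node_false.1 h)
    · simpa [leafAddrs, Function.comp_def] using hr (isAddr_node_true.1 h)

/-- The amplitude of a leaf in the state `Φ_u`. -/
def amp (t : PebbledTree C) (u : List Bool) (ℓ : ℕ) : ℝ :=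
  if u <+: t.leafAddr ℓ then (√(2 ^ ((t.leafAddr ℓ).length - u.length)))⁻¹ else 0

theorem sum_amp_sq {t : PebbledTree C} {w : List Bool} (h : t.IsAddr w) :
    ∑ ℓ ∈ Finset.range t.numLeaves, t.amp w ℓ * t.amp w ℓ = 1 := by
  rw [numLeaves, ← sum_leaf_weights h, Finset.sum_range, ← Fin.sum_univ_fun_getElem]
  refine Finset.sum_congr rfl fun i _ => ?_
  have hi : t.leafAddrs[(i : ℕ)] = t.leafAddr i := (leafAddr_eq_getElem t i.2).symm
  rw [hi, amp]
  split_ifs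
  · rw [← mul_inv, Real.mul_self_sqrt (by positivity)]
  · simp

/-- Depth differences add along a path, so amplitudes multiply: below w, the state Φ_u is a multiple
of Φ_w. -/
theorem amp_of_prefix {t : PebbledTree C} {u w : List Bool} (h : u <+: w) {ℓ : ℕ}
    (hℓ : w <+: t.leafAddr ℓ) :
    t.amp u ℓ = (√(2 ^ (w.length - u.length)))⁻¹ * t.amp w ℓ := by
  rw [amp, amp, if_pos hℓ, if_pos (h.trans hℓ), ← mul_inv, ← Real.sqrt_mul (by positivity),
    ← pow_add]
  have := h.length_le
  have := hℓ.length_le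
  congr 4
  omega

variable {ι : Type} [DecidableEq ι]

theorem Phi_eq_sum_amp (t : PebbledTree C) (s : ℕ → ι) (u : List Bool) :
    Phi t s u = ∑ ℓ ∈ Finset.range t.numLeaves, (t.amp u ℓ : ℂ) • ket (s ℓ) := by
  rw [Phi, leavesBelow, Finset.sum_filter]
  refine Finset.sum_congr rfl fun ℓ _ => ?_
  rw [amp]
  split_ifs <;> simp

theorem Phi_leafAddr (t : PebbledTree C) (s : ℕ → ι) {ℓ : ℕ} (h : ℓ < t.numLeaves) :
    Phi t s (t.leafAddr ℓ) = ket (s ℓ) := by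
  have : t.leavesBelow (t.leafAddr ℓ) = {ℓ} := by
    ext ℓ'
    rw [mem_leavesBelow, Finset.mem_singleton]
    constructor
    · rintro ⟨h1, h2⟩
      rcases lt_trichotomy ℓ ℓ' with hl | hl | hl
      · exact absurd List.prefix_rfl ((leafAddr_leftOf t hl h1).not_prefix h2)
      · exact hl.symm
      · exact absurd h2 ((leafAddr_leftOf t hl h).not_prefix List.prefix_rfl)
    · rintro rfl
      exact ⟨h, List.prefix_rfl⟩
  rw [Phi, this]
  simp

/-- The parameter `β` allows the child on the search path to be put first, whichever side it is on.
-/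
theorem Phi_eq_children {t : PebbledTree C} (s : ℕ → ι) {v : List Bool} (hv : v ∈ t.vertices)
    (β : Bool) :
    Phi t s v = (((√2)⁻¹ : ℝ) : ℂ) • (Phi t s (v ++ [β]) + Phi t s (v ++ [!β])) := by
  have key : Phi t s v =
      (((√2)⁻¹ : ℝ) : ℂ) • (Phi t s (v ++ [false]) + Phi t s (v ++ [true])) := by
    rw [Phi_eq_sum_amp, Phi_eq_sum_amp, Phi_eq_sum_amp, ← Finset.sum_add_distrib, Finset.smul_sum]
    refine Finset.sum_congr rfl fun ℓ hℓ => ?_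
    rw [Finset.mem_range] at hℓ
    rw [← add_smul, smul_smul, ← Complex.ofReal_add, ← Complex.ofReal_mul]
    congr 2
    by_cases h : v <+: t.leafAddr ℓ
    · have hne : v ≠ t.leafAddr ℓ := by
        rintro rfl
        have h1 := (isAddr_child_iff t _ false).2 hv
        have h2 := eq_of_prefix_of_mem_leafAddrs (leafAddr_mem t hℓ) h1 (List.prefix_append _ _)
        simp at h2
      obtain ⟨β, hβ⟩ := exists_child_prefix h hne
      rw [amp_of_prefix (List.prefix_append v [β]) hβ]
      have h0 : t.amp (v ++ [!β]) ℓ = 0 := by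
        rw [amp, if_neg]
        cases β
        · exact (leftOf_children v).not_prefix hβ
        · exact fun h' => (leftOf_children v).not_prefix h' hβ
      cases β <;> simp only [Bool.not_true, Bool.not_false] at h0 <;> simp [h0]
    · have : ∀ β, t.amp (v ++ [β]) ℓ = 0 := fun β => by
        rw [amp, if_neg]
        exact fun h' => h ((List.prefix_append _ _).trans h')
      rw [this, this, amp, if_neg h]
      simp
  cases β
  · exact key
  · rw [key, add_comm]; rfl

variable [Fintype ι]

theorem star_Phi_dotProduct {t : PebbledTree C} {s : ℕ → ι}
    (hs : Set.InjOn s (Set.Iio t.numLeaves)) (u w : List Bool) :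
    star (Phi t s u) ⬝ᵥ Phi t s w =
      ((∑ ℓ ∈ Finset.range t.numLeaves, t.amp u ℓ * t.amp w ℓ : ℝ) : ℂ) := by
  rw [Phi_eq_sum_amp, Phi_eq_sum_amp]
  simp only [star_sum, sum_dotProduct, dotProduct_sum, star_smul, smul_dotProduct,
    dotProduct_smul, star_ket_dotProduct, ket_apply, smul_eq_mul, mul_ite, mul_one, mul_zero]
  push_cast
  refine Finset.sum_congr rfl fun ℓ hℓ => ?_
  rw [Finset.sum_eq_single ℓ]
  · simp [mul_comm]
  · intro ℓ' hℓ' hne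
    rw [if_neg]
    exact fun h => hne (hs (Finset.mem_range.1 hℓ') (Finset.mem_range.1 hℓ) h)
  · exact fun h => absurd hℓ h

theorem star_Phi_dotProduct_of_prefix {t : PebbledTree C} {s : ℕ → ι}
    (hs : Set.InjOn s (Set.Iio t.numLeaves)) {u w : List Bool} (hw : t.IsAddr w) (h : u <+: w) :
    star (Phi t s u) ⬝ᵥ Phi t s w = (((√(2 ^ (w.length - u.length)))⁻¹ : ℝ) : ℂ) := by
  rw [star_Phi_dotProduct hs]
  congr 1
  rw [← mul_one (√(2 ^ (w.length - u.length)))⁻¹, ← sum_amp_sq hw, Finset.mul_sum]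
  refine Finset.sum_congr rfl fun ℓ _ => ?_
  by_cases hℓ : w <+: t.leafAddr ℓ
  · rw [amp_of_prefix h hℓ, mul_assoc]
  · simp [amp, hℓ]

theorem star_Phi_dotProduct_of_leftOf {t : PebbledTree C} {s : ℕ → ι}
    (hs : Set.InjOn s (Set.Iio t.numLeaves)) {u w : List Bool} (h : LeftOf u w ∨ LeftOf w u) :
    star (Phi t s u) ⬝ᵥ Phi t s w = 0 := by
  rw [star_Phi_dotProduct hs, Finset.sum_eq_zero, Complex.ofReal_zero]
  intro ℓ _
  by_cases hu : u <+: t.leafAddr ℓ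
  · have : ¬ w <+: t.leafAddr ℓ := by
      rcases h with h | h
      · exact h.not_prefix hu
      · exact fun hw => h.not_prefix hw hu
    simp [amp, this]
  · simp [amp, hu]

end PebbledTree

/-! ### Ordered inputs -/

theorem bit_of_lt {N : ℕ} (x : Fin N → Bool) {i : ℕ} (h : i < N) : bit x i = x ⟨i, h⟩ :=
  dif_pos h

theorem bit_of_le {N : ℕ} (x : Fin N → Bool) {i : ℕ} (h : N ≤ i) : bit x i = false :=
  dif_neg (not_lt.2 h)

theorem phase_of_le {N : ℕ} (x : Fin N → Bool) {i : ℕ} (h : N ≤ i) : phase x i = 1 := by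
  simp [phase, bit_of_le x h]

theorem bit_leftmostOne {N : ℕ} {x : Fin N → Bool} (hx : x ∈ orderedInputs N) :
    bit x (leftmostOne x) = true := by
  obtain ⟨-, i, hi⟩ := hx
  have : (i : ℕ) ∈ {i | bit x i = true} := by
    simpa [bit_of_lt x i.2] using hi
  exact Nat.sInf_mem ⟨_, this⟩

theorem leftmostOne_lt {N : ℕ} {x : Fin N → Bool} (hx : x ∈ orderedInputs N) :
    leftmostOne x < N := by
  by_contra h
  have := bit_leftmostOne hx
  rw [bit_of_le x (not_lt.1 h)] at this
  simp at this

theorem bit_eq_true_iff {N : ℕ} {x : Fin N → Bool} (hx : x ∈ orderedInputs N) {i : ℕ}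
    (hi : i < N) : bit x i = true ↔ leftmostOne x ≤ i := by
  constructor
  · exact fun h => Nat.sInf_le h
  · intro h
    have h1 := bit_leftmostOne hx
    rw [bit_of_lt x (leftmostOne_lt hx)] at h1
    rw [bit_of_lt x hi]
    have h2 := hx.1 (show (⟨_, leftmostOne_lt hx⟩ : Fin N) ≤ ⟨i, hi⟩ from h)
    rw [h1] at h2
    exact Bool.eq_true_of_true_le h2

theorem orderedInputs_of_threshold {M m : ℕ} {y : Fin M → Bool} (hm : m < M)
    (h : ∀ j : Fin M, y j = true ↔ m ≤ j) : y ∈ orderedInputs M ∧ leftmostOne y = m := by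
  have hy : y ∈ orderedInputs M := by
    refine ⟨fun i j hij => ?_, ⟨m, hm⟩, (h _).2 le_rfl⟩
    by_cases hi : y i = true
    · rw [(h j).2 (((h i).1 hi).trans hij)]
      exact Bool.le_true _
    · rw [Bool.not_eq_true] at hi
      rw [hi]
      exact Bool.false_le _
  refine ⟨hy, le_antisymm ?_ ?_⟩
  · rw [← bit_eq_true_iff hy hm, bit_of_lt y hm]
    exact (h _).2 le_rfl
  · have := bit_leftmostOne hy
    rw [bit_of_lt y (leftmostOne_lt hy)] at this
    exact (h _).1 this

namespace PebbledTree

/-! ### Fair and tight coverings -/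

variable {C : Type} {t : PebbledTree C}

theorem pAncestors_take {a : List Bool} {m : ℕ} (h : m ≤ a.length) :
    t.pAncestors (a.take m) = ∑ k ∈ Finset.range m, t.p (a.take k) := by
  rw [pAncestors, List.length_take, min_eq_left h]
  refine Finset.sum_congr rfl fun k hk => ?_
  rw [List.take_take, min_eq_left (Finset.mem_range.1 hk).le]

theorem pAncestors_concat (v : List Bool) (β : Bool) :
    t.pAncestors (v ++ [β]) = t.pAncestors v + t.p v := by
  rw [pAncestors, List.length_append, List.length_singleton, Finset.sum_range_succ, pAncestors]
  congr 1
  · refine Finset.sum_congr rfl fun k hk => ?_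
    rw [List.take_append_of_le_length (Finset.mem_range.1 hk).le]
  · simp

/-- The bit is 1 exactly if f(x) is at most the last leaf on the left, that is, if the path turns
left. This leaf is never the padding leaf: some leaf lies to its right, and there are at most `N +
1` leaves. -/
theorem bit_rightmostLeaf_false {N : ℕ} (hL : t.numLeaves ≤ N + 1) (hL' : N ≤ t.numLeaves)
    {x : Fin N → Bool} (hx : x ∈ orderedInputs N) {v : List Bool} {β : Bool}
    (h : v ++ [β] <+: t.leafAddr (leftmostOne x)) :
    bit x (t.rightmostLeaf (v ++ [false])) = !β := by
  have hf := leftmostOne_lt hx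
  have hmem := mem_leavesBelow.2 ⟨hf.trans_le hL', h⟩
  have hv : v ∈ t.vertices := (isAddr_child_iff t v β).1 ⟨_, leafAddr_mem t (hf.trans_le hL'), h⟩
  have h0 := rightmostLeaf_mem ((isAddr_child_iff t v false).2 hv)
  have h1 := rightmostLeaf_mem ((isAddr_child_iff t v true).2 hv)
  have hlt := lt_of_leftOf (leftOf_children v) h0 h1
  have hlt' := (mem_leavesBelow.1 h1).1
  cases β
  · exact (bit_eq_true_iff hx (by omega)).2 (le_rightmostLeaf hmem)
  · rw [Bool.not_true, ← Bool.not_eq_true, bit_eq_true_iff hx (by omega), not_le]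
    exact lt_of_leftOf (leftOf_children v) h0 hmem

variable [DecidableEq C] {N' : ℕ}

/-- Two comparable vertices lie on a common path to a leaf, which has only one pebble of each color.
-/
theorem IsFairTightCovering.antichain (hc : t.IsFairTightCovering N') {c : C} {u w : List Bool}
    (hu : c ∈ t.peb u) (hw : c ∈ t.peb w) (h : u <+: w) : u = w := by
  obtain ⟨a, ha, hβ⟩ := (isAddr_child_iff t w false).2 (mem_vertices_of_mem_peb hw)
  have hwa : w <+: a := (List.prefix_append _ _).trans hβ
  have hlen : w.length < a.length := by
    have := hβ.length_le
    simp at this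
    omega
  obtain ⟨k, -, hk⟩ := hc.one_per_path a ha c
  have h1 := hk w.length ⟨hlen, by rwa [← List.prefix_iff_eq_take.1 hwa]⟩
  have h2 := hk u.length ⟨h.length_le.trans_lt hlen,
    by rwa [← List.prefix_iff_eq_take.1 (h.trans hwa)]⟩
  exact h.eq_of_length (h2.trans h1.symm)

theorem mem_colorVertices {c : C} {v : List Bool} : v ∈ t.colorVertices c ↔ c ∈ t.peb v := by
  simp only [colorVertices, List.mem_filter, decide_eq_true_eq, and_iff_right_iff_imp]
  exact mem_vertices_of_mem_peb

theorem IsFairTightCovering.colorVertices_pairwise (hc : t.IsFairTightCovering N') (c : C) :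
    (t.colorVertices c).Pairwise LeftOf := by
  have h : (t.vertices.filter fun v => c ∈ t.peb v).Pairwise fun u w => LeftOf u w ∨ u = w := by
    rw [List.pairwise_filter]
    refine t.vertices_pairwise.imp fun {u w} h hu hw => ?_
    simp only [decide_eq_true_eq] at hu hw
    rcases h with h | h | h
    · exact Or.inl h
    · exact Or.inr (hc.antichain hu hw h)
    · exact Or.inr (hc.antichain hw hu h).symm
  have hnd : (t.colorVertices c).Nodup := by
    refine List.Nodup.filter _ ?_
    clear h hc
    induction t with
    | leaf => simp [vertices]
    | node P l r hl hr =>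
      simp only [vertices]
      refine List.Nodup.append (hl.map fun _ _ h => by simpa using h)
        (List.Nodup.cons (by simp) (hr.map fun _ _ h => by simpa using h)) ?_
      intro a ha hb
      obtain ⟨a, _, rfl⟩ := List.mem_map.1 ha
      simp at hb
  exact (h.and hnd).imp fun h => h.1.resolve_right h.2

/-- Along a fixed path every color occurs at exactly one depth, so a sum over colors can be
regrouped by the vertices of the path. -/
theorem IsFairTightCovering.sum_colors [Fintype C] (hc : t.IsFairTightCovering N')
    {a : List Bool} (ha : a ∈ t.leafAddrs) {M : Type} [AddCommMonoid M] (F : C → M)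
    (G : ℕ → C → M)
    (h : ∀ k < a.length, ∀ c ∈ t.peb (a.take k), F c = G k c) :
    ∑ c, F c = ∑ k ∈ Finset.range a.length, ∑ c ∈ t.peb (a.take k), G k c := by
  have h1 : ∀ k, ∑ c ∈ t.peb (a.take k), G k c = ∑ c, if c ∈ t.peb (a.take k) then G k c else 0 := by
    intro k
    rw [← Finset.sum_filter]
    congr 1
    ext c
    simp
  rw [Finset.sum_congr rfl fun k _ => h1 k, Finset.sum_comm]
  refine Finset.sum_congr rfl fun c _ => ?_
  obtain ⟨k, ⟨hk, hk'⟩, huniq⟩ := hc.one_per_path a ha c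
  rw [Finset.sum_eq_single k]
  · rw [if_pos hk', h k hk c hk']
  · intro j hj hne
    rw [if_neg]
    exact fun hj' => hne (huniq j ⟨Finset.mem_range.1 hj, hj'⟩)
  · exact fun h => absurd (Finset.mem_range.2 hk) h

theorem IsFairTightCovering.sum_p [Fintype C] (hc : t.IsFairTightCovering N')
    {a : List Bool} (ha : a ∈ t.leafAddrs) :
    ∑ k ∈ Finset.range a.length, t.p (a.take k) = Fintype.card C := by
  have := hc.sum_colors ha (fun _ => (1 : ℕ)) (fun _ _ => 1) (fun _ _ _ _ => rfl)
  simpa [p] using this.symm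

/-- If the parent has no pebbles, then neither do its ancestors, because it has at least as many as
they have in total. Thus the local case distinction of the algorithm is the one between P = 0 and P
> 0. -/
theorem parentBare_iff {a : List Bool} (hc : t.IsFairTightCovering N') {m : ℕ}
    (ha : t.IsAddr a) (hm : m < a.length) :
    t.ParentBare (a.take m) ↔ t.pAncestors (a.take m) = 0 := by
  rcases m with _ | m
  · simp [ParentBare, pAncestors]
  · have h0 : a.take (m + 1) ≠ [] := by
      rw [← List.length_pos_iff, List.length_take]
      omega
    have h1 : (a.take (m + 1)).dropLast = a.take m := by
      rw [List.dropLast_take hm, Nat.add_sub_cancel]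
    have h2 := hc.ancestors_le _ (take_mem_vertices ha (m.lt_succ_self.trans hm))
    rw [pAncestors_take (by omega)] at h2
    rw [ParentBare, h1, pAncestors_take hm.le, Finset.sum_range_succ]
    simp only [h0, false_or]
    omega

/-! ### The recursive search for one color -/

/-- The input of the recursive search for the color `c`. -/
def subInput {N : ℕ} (x : Fin N → Bool) (M : ℕ) (t : PebbledTree C) (c : C) : Fin M → Bool :=
  fun j => bit x (subIndex N t c j)

/-- Vertices of one color have disjoint subtrees ordered from left to right. Those left of `v` end
before f(x), while `v` and those right of it end at or after f(x). So the list of their last bits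
jumps to 1 at the position of `v`. -/
theorem IsFairTightCovering.subInput_spec (hc : t.IsFairTightCovering N') {N M : ℕ}
    (hL : N ≤ t.numLeaves) (hM : N' ≤ M) {x : Fin N → Bool} (hx : x ∈ orderedInputs N) {c : C}
    {v : List Bool} (hv : c ∈ t.peb v) (hvf : v <+: t.leafAddr (leftmostOne x)) :
    subInput x M t c ∈ orderedInputs M ∧
      leftmostOne (subInput x M t c) = (t.colorVertices c).idxOf v := by
  have hf := leftmostOne_lt hx
  have hmem : leftmostOne x ∈ t.leavesBelow v := mem_leavesBelow.2 ⟨hf.trans_le hL, hvf⟩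
  have hi : (t.colorVertices c).idxOf v < (t.colorVertices c).length :=
    List.idxOf_lt_length_of_mem (mem_colorVertices.2 hv)
  have hget : (t.colorVertices c)[(t.colorVertices c).idxOf v] = v := List.getElem_idxOf hi
  have hpw := List.pairwise_iff_getElem.1 (hc.colorVertices_pairwise c)
  have haddr : ∀ j (hj : j < (t.colorVertices c).length), t.IsAddr (t.colorVertices c)[j] :=
    fun j hj => isAddr_of_mem_vertices
      (mem_vertices_of_mem_peb (mem_colorVertices.1 (List.getElem_mem hj)))
  refine orderedInputs_of_threshold (hi.trans_le ((hc.count_le c).trans hM)) fun j => ?_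
  rw [subInput, subIndex]
  split_ifs with hj
  · rw [bit_eq_true_iff hx (by omega)]
    -- Replacing the padding leaf by `N - 1` changes nothing, because f(x) is at most `N - 1`.
    have : leftmostOne x ≤ min (t.rightmostLeaf (t.colorVertices c)[(j : ℕ)]) (N - 1) ↔
        leftmostOne x ≤ t.rightmostLeaf (t.colorVertices c)[(j : ℕ)] := by omega
    rw [this]
    rcases lt_trichotomy ((t.colorVertices c).idxOf v) (j : ℕ) with h | h | h
    · refine iff_of_true (lt_of_leftOf ?_ hmem (rightmostLeaf_mem (haddr j hj))).le h.le
      have := hpw _ _ hi hj h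
      rwa [hget] at this
    · refine iff_of_true (le_rightmostLeaf ?_) h.le
      simp only [← h, hget]
      exact hmem
    · refine iff_of_false (not_le.2 (lt_of_leftOf ?_ (rightmostLeaf_mem (haddr j hj)) hmem))
        (not_le.2 h)
      have := hpw _ _ hj hi h
      rwa [hget] at this
  -- The missing items repeat the last bit, which is 1, and they come after the position of `v`.
  · rw [bit_eq_true_iff hx (by omega)]
    exact iff_of_true (by omega) (by omega)

end PebbledTree

/-! ### Correctness of one level of the recursion -/

namespace PebbleStep

open PebbledTree

variable {C : Type} [Fintype C] [DecidableEq C] {N M : ℕ} {t : PebbledTree C} {A' A : Circuit}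

/-- The joint state of the recursive searches for all colors. -/
def joint (S : PebbleStep N M t A' A) (x : Fin N → Bool) (j : ℕ) : A.ι → ℂ :=
  (((√(Fintype.card C))⁻¹ : ℝ) : ℂ) •
    ∑ c, ∑ b, A'.state (subInput x M t c) j b • ket (S.reg b c)

theorem lift_mulVec (S : PebbleStep N M t A' A) {j : ℕ} (hj : j ≤ A'.queries)
    (ψ : C → A'.ι → ℂ) :
    (S.lift j : Matrix A.ι A.ι ℂ) *ᵥ ∑ c, ∑ b, ψ c b • ket (S.reg b c) =
      ∑ c, ∑ b, ((A'.U j : Matrix A'.ι A'.ι ℂ) *ᵥ ψ c) b • ket (S.reg b c) := by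
  simp only [Matrix.mulVec_sum, Matrix.mulVec_smul, S.lift_spec j hj]
  refine Finset.sum_congr rfl fun c _ => ?_
  simp only [Finset.smul_sum, smul_smul, Matrix.mulVec, dotProduct, Finset.sum_smul]
  rw [Finset.sum_comm]
  exact Finset.sum_congr rfl fun b _ => Finset.sum_congr rfl fun b' _ => by rw [mul_comm]

theorem oracle_reg (S : PebbleStep N M t A' A) (x : Fin N → Bool) (b : A'.ι) (c : C) :
    phase x (A.idx (S.reg b c)) = phase (subInput x M t c) (A'.idx b) := by
  rcases lt_or_ge (A'.idx b) M with h | h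
  · rw [S.reg_idx b c h, phase, phase, bit_of_lt _ h]
    rfl
  · rw [phase_of_le _ (S.reg_idx' b c h), phase_of_le _ h]

/-- Each color owns its own block of basis states, so a single query to `x` serves the recursive
searches of all colors at once, each with its own input. -/
theorem oracle_joint (S : PebbleStep N M t A' A) (x : Fin N → Bool) (ψ : C → A'.ι → ℂ) :
    oracle A.idx x *ᵥ ∑ c, ∑ b, ψ c b • ket (S.reg b c) =
      ∑ c, ∑ b, (oracle A'.idx (subInput x M t c) *ᵥ ψ c) b • ket (S.reg b c) := by
  simp only [Matrix.mulVec_sum, Matrix.mulVec_smul, oracle_mulVec_ket, oracle_mulVec_apply,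
    S.oracle_reg, smul_smul]
  exact Finset.sum_congr rfl fun c _ => Finset.sum_congr rfl fun b _ => by rw [mul_comm]

theorem joint_zero (S : PebbleStep N M t A' A) (x : Fin N → Bool) :
    S.joint x 0 = (S.lift 0 : Matrix A.ι A.ι ℂ) *ᵥ
      ((S.prep : Matrix A.ι A.ι ℂ) *ᵥ ket A.start) := by
  have : ∀ c, ket (S.reg A'.start c) =
      ∑ b, (ket A'.start : A'.ι → ℂ) b • (ket (S.reg b c) : A.ι → ℂ) := by
    intro c
    simp [ket_apply]
  rw [S.prep_spec, Matrix.mulVec_smul, Finset.sum_congr rfl fun c _ => this c,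
    S.lift_mulVec (Nat.zero_le _) fun _ => ket A'.start]
  rfl

theorem joint_succ (S : PebbleStep N M t A' A) (x : Fin N → Bool) {j : ℕ}
    (hj : j + 1 ≤ A'.queries) :
    S.joint x (j + 1) =
      (S.lift (j + 1) : Matrix A.ι A.ι ℂ) *ᵥ (oracle A.idx x *ᵥ S.joint x j) := by
  rw [joint, joint, Matrix.mulVec_smul, Matrix.mulVec_smul, S.oracle_joint, S.lift_mulVec hj]
  rfl

/-- Before its last query, the circuit merely runs the recursive searches in parallel. The factor in
front appears only at the end, where the operator preparing the last query is merged with the last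
operator of the recursion. -/
theorem state_eq_joint (S : PebbleStep N M t A' A) (x : Fin N → Bool) {j : ℕ}
    (hj : j ≤ A'.queries) :
    A.state x j = (((if j = A'.queries then S.qPre * S.U₁⁻¹ else 1 :
      Matrix.unitaryGroup A.ι ℂ)) : Matrix A.ι A.ι ℂ) *ᵥ S.joint x j := by
  induction j with
  | zero =>
    rw [Circuit.state, S.U_eq 0 hj, if_pos rfl, S.joint_zero]
    simp only [Submonoid.coe_mul, Matrix.mulVec_mulVec, Matrix.mul_assoc]
  | succ j ih =>
    rw [Circuit.state, ih (by omega), if_neg (by omega), S.U_eq _ hj, if_neg j.succ_ne_zero,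
      S.joint_succ x hj]
    simp only [Submonoid.coe_mul, Submonoid.coe_one, mul_one, Matrix.mulVec_mulVec,
      Matrix.mul_assoc]

variable {N' : ℕ}

/-- A vertex has p_v colors, and `U₁` gives each of them amplitude 1/√p_v. The weight √p_v cancels
this, so all colors on the path get amplitude 1. Read backwards, this turns the found vertices into
weighted path vertices. -/
theorem U₁_mulVec_path (S : PebbleStep N M t A' A) (hc : t.IsFairTightCovering N')
    {a : List Bool} (ha : a ∈ t.leafAddrs) (j : C → ℕ)
    (hj : ∀ k < a.length, ∀ c ∈ t.peb (a.take k), j c = (t.colorVertices c).idxOf (a.take k)) :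
    (S.U₁ : Matrix A.ι A.ι ℂ) *ᵥ
      ∑ k ∈ Finset.range a.length, (√(t.p (a.take k)) : ℂ) • ket (S.vtx (a.take k)) =
      ∑ c, ket (S.reg (A'.ans (j c)) c) := by
  rw [hc.sum_colors ha _
    (fun k c => ket (S.reg (A'.ans ((t.colorVertices c).idxOf (a.take k))) c))
    (fun k hk c hck => by rw [hj k hk c hck]), Matrix.mulVec_sum]
  refine Finset.sum_congr rfl fun k _ => ?_
  rw [Matrix.mulVec_smul]
  rcases Nat.eq_zero_or_pos (t.p (a.take k)) with h | h
  · rw [h, Finset.card_eq_zero.1 h]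
    simp
  · rw [S.U₁_spec _ h, smul_smul, ← Complex.ofReal_mul, mul_inv_cancel₀ (by positivity),
      Complex.ofReal_one, one_smul]

open Classical in
/-- The effect of the last query and the operators around it on a pebbled vertex. -/
theorem query_vtx (S : PebbleStep N M t A' A) (hL : t.numLeaves ≤ N + 1) (hL' : N ≤ t.numLeaves)
    {x : Fin N → Bool} (hx : x ∈ orderedInputs N) {v : List Bool} {β : Bool} (hv : 0 < t.p v)
    (h : v ++ [β] <+: t.leafAddr (leftmostOne x)) :
    (A.U (A'.queries + 1) : Matrix A.ι A.ι ℂ) *ᵥ (oracle A.idx x *ᵥ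
      ((S.qPre : Matrix A.ι A.ι ℂ) *ᵥ ket (S.vtx v))) =
      if t.ParentBare v then Phi t S.leafState (v ++ [β])
      else (√2 : ℂ) • Phi t S.leafState (v ++ [β]) - Phi t S.leafState v := by
  have h2 : ((√2 : ℝ) : ℂ) * ((√2 : ℝ) : ℂ) = 2 := by
    rw [← Complex.ofReal_mul, Real.mul_self_sqrt (by norm_num)]
    norm_num
  have h2' : ((√2 : ℝ) : ℂ) ≠ 0 := by
    intro h0
    rw [h0] at h2
    norm_num at h2
  have hbit := bit_rightmostLeaf_false hL hL' hx h
  have hstep : (A.U (A'.queries + 1) : Matrix A.ι A.ι ℂ) *ᵥ (oracle A.idx x *ᵥ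
      ((S.qPre : Matrix A.ι A.ι ℂ) *ᵥ ket (S.vtx v))) = (S.U₂ : Matrix A.ι A.ι ℂ) *ᵥ
      (((S.qPost : Matrix A.ι A.ι ℂ) * oracle A.idx x * (S.qPre : Matrix A.ι A.ι ℂ)) *ᵥ
        ket (S.vtx v)) := by
    rw [S.U_last]
    simp only [Submonoid.coe_mul, Matrix.mulVec_mulVec, Matrix.mul_assoc]
  rw [hstep]
  split_ifs with hb
  · rw [S.query_bare x v hv hb, hbit]
    cases β
    · exact S.U₂_bare_one v hv hb
    · exact S.U₂_bare_zero v hv hb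
  -- The phase gives the child on the path the positive sign. The difference of the children divided
  -- by √2 is then √2 Φ_child - Φ_v, because Φ_v is their sum divided by √2.
  · rw [S.query_pebbled x v hv hb, Matrix.mulVec_smul, S.U₂_pebbled v hv hb, phase, hbit,
      Phi_eq_children S.leafState (mem_vertices_of_p_pos hv) β]
    ext i
    simp only [Pi.smul_apply, Pi.sub_apply, Pi.add_apply, smul_eq_mul, Complex.ofReal_inv]
    cases β <;> simp only [Bool.not_true, Bool.not_false, if_true, Bool.false_eq_true, if_false]
      <;> field_simp <;> rw [pow_two, h2] <;> ring

/-- **One level of the recursion is correct.** -/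
theorem searchesExactly [Nonempty C] (S : PebbleStep N M t A' A) (hc : t.IsFairTightCovering N')
    (hL : t.numLeaves ≤ N + 1) (hL' : N ≤ t.numLeaves) (hM : N' ≤ M)
    (hA' : A'.SearchesExactly M) : A.SearchesExactly N := by
  classical
  refine ⟨fun k hk k' hk' h => ?_, fun x hx => ?_⟩
  · rw [S.ans_eq k hk, S.ans_eq k' hk'] at h
    exact S.leafState_inj (lt_of_lt_of_le hk hL') (lt_of_lt_of_le hk' hL') h
  have hf := leftmostOne_lt hx
  have hfL := hf.trans_le hL'
  set a := t.leafAddr (leftmostOne x) with ha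
  have haL : a ∈ t.leafAddrs := leafAddr_mem t hfL
  have haA := isAddr_of_mem_leafAddrs haL
  have hjoint : S.joint x A'.queries = (((√(Fintype.card C))⁻¹ : ℝ) : ℂ) •
      ∑ c, ket (S.reg (A'.ans (leftmostOne (subInput x M t c))) c) := by
    rw [joint]
    congr 1
    refine Finset.sum_congr rfl fun c _ => ?_
    obtain ⟨k, ⟨hk, hk'⟩, -⟩ := hc.one_per_path a haL c
    have := hc.subInput_spec hL' hM hx hk' (List.take_prefix _ _)
    rw [hA'.2 _ this.1]
    simp [ket_apply]
  rw [← S.U₁_mulVec_path hc haL _ fun k hk c hck =>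
    (hc.subInput_spec hL' hM hx hck (List.take_prefix _ _)).2, ← Matrix.mulVec_smul] at hjoint
  -- The telescoping invariant: the images of the first `m` path vertices add up to a multiple of
  -- the single state Φ at depth `m`.
  have hpath : ∀ m ≤ a.length, ∑ k ∈ Finset.range m, (√(t.p (a.take k)) : ℂ) •
      ((A.U (A'.queries + 1) : Matrix A.ι A.ι ℂ) *ᵥ (oracle A.idx x *ᵥ
        ((S.qPre : Matrix A.ι A.ι ℂ) *ᵥ ket (S.vtx (a.take k))))) =
      (√(t.pAncestors (a.take m)) : ℂ) • Phi t S.leafState (a.take m) := by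
    intro m
    induction m with
    | zero => simp [pAncestors]
    | succ m ih =>
      intro hm
      have hm' : m < a.length := hm
      have hv := take_mem_vertices haA hm'
      have htake : a.take (m + 1) = a.take m ++ [a[m]] := by simp
      rw [Finset.sum_range_succ, ih hm'.le, htake, pAncestors_concat]
      rcases Nat.eq_zero_or_pos (t.p (a.take m)) with h0 | h0
      -- A vertex without pebbles has none above it either, so both sides vanish.
      · have := hc.ancestors_le _ hv
        rw [h0, Nat.le_zero] at this
        simp [h0, this]
      · rw [S.query_vtx hL hL' hx h0 (β := a[m]) (by rw [← htake]; exact List.take_prefix _ _)]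
        simp only [parentBare_iff hc haA hm']
        split_ifs with hb
        · simp [hb]
        -- With p_v = P, the term -√p_v Φ_v cancels the previous partial sum, and √p_v √2 = √(2P)
        -- remains.
        · rw [(hc.tight _ hv).resolve_right hb, ← two_mul, Nat.cast_mul, Real.sqrt_mul (by simp),
            Complex.ofReal_mul, smul_sub, smul_smul, mul_comm]
          simp
  have hfin : A.state x A.queries = (A.U (A'.queries + 1) : Matrix A.ι A.ι ℂ) *ᵥ
      (oracle A.idx x *ᵥ A.state x A'.queries) := by
    rw [S.queries_eq]; rfl
  rw [hfin, S.state_eq_joint x le_rfl, if_pos rfl, Submonoid.coe_mul, ← Matrix.mulVec_mulVec,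
    unitary_inv_mulVec S.U₁ hjoint.symm]
  have hlast := hpath a.length le_rfl
  rw [pAncestors_take le_rfl, hc.sum_p haL, List.take_length, ha, Phi_leafAddr t _ hfL] at hlast
  simp only [Matrix.mulVec_smul, Matrix.mulVec_sum]
  rw [hlast, smul_smul, ← Complex.ofReal_mul, S.ans_eq _ hf]
  have hC : (0 : ℝ) < Fintype.card C := Nat.cast_pos.2 Fintype.card_pos
  rw [inv_mul_cancel₀ (by positivity), Complex.ofReal_one, one_smul]

end PebbleStep

/-! ### Circuits and black box algorithms -/

theorem phase_congr {N : ℕ} (x : Fin N → Bool) {i j : ℕ} (h : min i N = min j N) :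
    phase x i = phase x j := by
  rcases lt_or_ge i N with hi | hi
  · have : i = j := by omega
    rw [this]
  · rw [phase_of_le x hi, phase_of_le x (by omega)]

/-- The labelling `e t` is the one in force before the operator number `t`. After `j` queries `j +
1` operators have acted, hence the shift to `e (j + 1)`. -/
theorem BlackBoxAlgorithm.Implements.state_eq {B : BlackBoxAlgorithm} {N : ℕ} {A : Circuit}
    {e : ℕ → A.ι → B.Basis} (he0 : e 0 A.start = (0, 0))
    (hU : ∀ t ≤ B.T, ∀ b, (B.U : Matrix B.Basis B.Basis ℂ) *ᵥ ket (e t b) =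
      ∑ b', (A.U t : Matrix A.ι A.ι ℂ) b' b • ket (e (t + 1) b'))
    (hidx : ∀ t, 1 ≤ t → t ≤ B.T → ∀ b, min ((e t b).2 : ℕ) N = min (A.idx b) N)
    (x : Fin N → Bool) {j : ℕ} (hj : j ≤ B.T) :
    B.state x j = ∑ b, A.state x j b • ket (e (j + 1) b) := by
  induction j with
  | zero =>
    rw [BlackBoxAlgorithm.state, pow_zero, one_mul, ← he0, hU 0 hj]
    simp only [Circuit.state, mulVec_ket_apply]
  | succ j ih =>
    have : B.state x (j + 1) = (B.U : Matrix B.Basis B.Basis ℂ) *ᵥ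
        (oracle (fun b : B.Basis => (b.2 : ℕ)) x *ᵥ B.state x j) := by
      simp only [BlackBoxAlgorithm.state, pow_succ', Matrix.mulVec_mulVec, Matrix.mul_assoc]
    rw [this, ih (by omega)]
    have h2 : ∀ b', A.state x (j + 1) b' = ∑ b, (A.U (j + 1) : Matrix A.ι A.ι ℂ) b' b *
        (phase x (A.idx b) * A.state x j b) := fun b' =>
      Finset.sum_congr rfl fun b _ => by rw [oracle_mulVec_apply]
    simp only [Matrix.mulVec_sum, Matrix.mulVec_smul, oracle_mulVec_ket, smul_smul, hU _ hj,
      phase_congr x (hidx (j + 1) (by omega) hj _), h2, Finset.smul_sum, Finset.sum_smul]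
    rw [Finset.sum_comm]
    exact Finset.sum_congr rfl fun b _ => Finset.sum_congr rfl fun b' _ => by
      congr 1
      ring

theorem BlackBoxAlgorithm.Implements.computes {B : BlackBoxAlgorithm} {N : ℕ} {A : Circuit}
    (h : B.Implements N A) (hA : A.SearchesExactly N) :
    B.Computes (orderedInputs N) (Nat.clog 2 N) leftmostOne 0 := by
  obtain ⟨hT, e, -, he0, hU, hidx, hans⟩ := h
  intro x hx
  have hs : B.state x B.T = ket (e (B.T + 1) (A.ans (leftmostOne x))) := by
    rw [BlackBoxAlgorithm.Implements.state_eq he0 hU hidx x le_rfl, hT, hA.2 x hx]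
    simp [ket_apply]
  rw [BlackBoxAlgorithm.prob, hs, sub_zero]
  have hk := hans _ (leftmostOne_lt hx)
  refine le_trans ?_ (Finset.single_le_sum (fun b _ => ?_)
    (Finset.mem_univ (e (B.T + 1) (A.ans (leftmostOne x)))))
  · rw [if_pos hk]
    simp [ket_apply]
  · split_ifs <;> positivity

/-- Every circuit with distinct answer states is carried out by a black box algorithm, with a
clock in the `z` register. -/
theorem exists_implements {N : ℕ} {A : Circuit} (hA : Set.InjOn A.ans (Set.Iio N)) :
    ∃ B : BlackBoxAlgorithm, B.Implements N A := by
  classical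
  let q := A.queries
  let Z := Fin (q + 2) × A.ι
  have hZ : Fintype.card Z = (Fintype.card Z - 1) + 1 := by
    have : 0 < Fintype.card Z := Fintype.card_pos_iff.2 ⟨(0, A.start)⟩
    omega
  obtain ⟨E, hE⟩ : ∃ E : Z ≃ Fin ((Fintype.card Z - 1) + 1), E (0, A.start) = 0 := by
    let E₀ := Fintype.equivFinOfCardEq hZ
    exact ⟨E₀.trans (Equiv.swap (E₀ (0, A.start)) 0), by simp⟩
  -- The index register is 0 at the start, holds the index of the circuit capped at `N` while
  -- queries are made, and holds the answer after the last operator.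
  let i : ℕ → A.ι → Fin (N + 1) := fun t b =>
    if t = 0 then 0 else if t ≤ q then Fin.ofNat (N + 1) (min (A.idx b) N)
    else if h : ∃ k < N, A.ans k = b then Fin.ofNat (N + 1) h.choose else 0
  let e : ℕ → A.ι → Fin ((Fintype.card Z - 1) + 1) × Fin (N + 1) :=
    fun t b => (E (Fin.ofNat (q + 2) t, b), i t b)
  -- The clock has `q + 2` values, one for each time, so labels of different times never collide.
  have he : ∀ t ≤ q + 1, ∀ t' ≤ q + 1, ∀ b b', e t b = e t' b' → b = b' ∧ t = t' := by
    intro t ht t' ht' b b' h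
    have h1 := E.injective (Prod.ext_iff.1 h).1
    have h2 := congrArg (fun z : Z => (z.1 : ℕ)) h1
    simp only [Fin.val_ofNat] at h2
    rw [Nat.mod_eq_of_lt (by omega), Nat.mod_eq_of_lt (by omega)] at h2
    exact ⟨congrArg Prod.snd h1, h2⟩
  -- All operators of the circuit act on disjoint time slices and move them to the next slice, so
  -- one unitary can extend them all.
  obtain ⟨U, hU⟩ := exists_unitary_map (κ := A.ι × Fin (q + 1))
    (f := fun r => ket (e r.2 r.1))
    (g := fun r => ∑ b', (A.U r.2 : Matrix A.ι A.ι ℂ) b' r.1 • ket (e (r.2 + 1) b'))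
    (orthonormalFamily_ket (e := fun r : A.ι × Fin (q + 1) => e r.2 r.1) fun r r' h => by
      have := he _ (by omega) _ (by omega) _ _ h
      exact Prod.ext this.1 (Fin.ext this.2))
    (orthonormalFamily_columns (fun t : Fin (q + 1) => A.U t) (fun b t => e (t + 1) b)
      fun b c b' c' h => by
        have := he _ (by omega) _ (by omega) _ _ h
        exact ⟨this.1, Fin.ext (by omega)⟩)
  refine ⟨⟨Fintype.card Z - 1, N, q, U⟩, rfl, e, fun t ht b b' h => (he t ht t ht _ _ h).1, ?_,
    fun t ht b => hU (b, ⟨t, Nat.lt_succ_of_le ht⟩), ?_, ?_⟩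
  · simp only [e, i, if_true]
    rw [Prod.mk.injEq]
    exact ⟨hE, rfl⟩
  · intro t ht ht' b
    have : i t b = Fin.ofNat (N + 1) (min (A.idx b) N) := by
      simp only [i]
      rw [if_neg (by omega), if_pos ht']
    simp only [e, this, Fin.val_ofNat]
    rw [Nat.mod_eq_of_lt (by omega)]
    omega
  · intro k hk
    have hex : ∃ k' < N, A.ans k' = A.ans k := ⟨k, hk, rfl⟩
    have : i (q + 1) (A.ans k) = Fin.ofNat (N + 1) k := by
      simp only [i]
      rw [if_neg (by omega), if_neg (by omega), dif_pos hex]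
      congr 1
      exact hA hex.choose_spec.1 hk hex.choose_spec.2
    change ((i (q + 1) (A.ans k) : Fin (N + 1)) : ℕ) % 2 ^ Nat.clog 2 N = k
    rw [this, Fin.val_ofNat, Nat.mod_eq_of_lt (hk.trans N.lt_succ_self),
      Nat.mod_eq_of_lt (hk.trans_le (Nat.le_pow_clog one_lt_two N))]

/-! ### Binary search for the base case -/

/-- Labels of the basis states of binary search on eight elements: in layer `j`, the state
`(j, n, β)` belongs to the `n`-th interval of length `2 ^ (3 - j)`. -/
abbrev BinaryLabel : Type := Fin 4 × Fin 8 × Bool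

namespace BinaryLabel

/-- The label `(j, n, β)`. -/
def mk (j n : ℕ) (β : Bool) : BinaryLabel := (Fin.ofNat 4 j, Fin.ofNat 8 n, β)

/-- The query that bisects an interval is made if the last component is `true`. -/
def index (N : ℕ) (b : BinaryLabel) : ℕ :=
  if b.2.2 then min (b.2.1 * 2 ^ (3 - (b.1 : ℕ)) + 2 ^ (2 - (b.1 : ℕ)) - 1) (N - 1) else N

theorem mk_inj {j n j' n' : ℕ} {β β' : Bool} (hj : j < 4) (hn : n < 8) (hj' : j' < 4)
    (hn' : n' < 8) (h : mk j n β = mk j' n' β') : (j = j' ∧ n = n') ∧ β = β' := by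
  simp only [mk, Prod.mk.injEq, Fin.ext_iff, Fin.val_ofNat] at h
  rw [Nat.mod_eq_of_lt hj, Nat.mod_eq_of_lt hj', Nat.mod_eq_of_lt hn, Nat.mod_eq_of_lt hn'] at h
  tauto

theorem index_mk_false (N j n : ℕ) : index N (mk j n false) = N := by
  simp [index, mk]

theorem index_mk_true (N : ℕ) {j n : ℕ} (hj : j < 4) (hn : n < 8) :
    index N (mk j n true) = min (n * 2 ^ (3 - j) + 2 ^ (2 - j) - 1) (N - 1) := by
  simp only [index, mk, if_true, Fin.val_ofNat]
  rw [Nat.mod_eq_of_lt hj, Nat.mod_eq_of_lt hn]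

theorem orthonormalFamily :
    OrthonormalFamily fun r : (Fin 4 × Fin 8) × Bool => plusMinus (mk r.1.1 r.1.2) r.2 :=
  orthonormalFamily_plusMinus (e := fun r : Fin 4 × Fin 8 => mk r.1 r.2) fun r _ r' _ h => by
    have := mk_inj r.1.2 r.2.2 r'.1.2 r'.2.2 h
    exact ⟨Prod.ext (Fin.ext this.1.1) (Fin.ext this.1.2), this.2⟩

theorem exists_start : ∃ U : Matrix.unitaryGroup BinaryLabel ℂ,
    (U : Matrix BinaryLabel BinaryLabel ℂ) *ᵥ ket (mk 3 0 false) = plusMinus (mk 0 0) false := by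
  obtain ⟨U, hU⟩ := exists_unitary_map (κ := Unit) (f := fun _ => ket (mk 3 0 false))
    (g := fun _ => plusMinus (mk 0 0) false) (orthonormalFamily_ket fun _ _ _ => rfl)
    (orthonormalFamily.comp (e := fun _ => ((0, 0), false)) fun _ _ _ => rfl)
  exact ⟨U, hU ()⟩

/-- The sign is 1 exactly if the left half is chosen. The information in the sign moves into the
interval number, which leaves a fresh `false` for the next query. Interval numbers below 4 suffice,
since layers before the last have at most 4 intervals. -/
theorem exists_bisect : ∃ V : Matrix.unitaryGroup BinaryLabel ℂ, ∀ j < 3, ∀ n < 4, ∀ σ : Bool,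
    (V : Matrix BinaryLabel BinaryLabel ℂ) *ᵥ plusMinus (mk j n) σ =
      plusMinus (mk (j + 1) (2 * n + if σ then 0 else 1)) false := by
  obtain ⟨V, hV⟩ := exists_unitary_map (κ := Fin 3 × Fin 4 × Bool)
    (f := fun r => plusMinus (mk r.1 r.2.1) r.2.2)
    (g := fun r => plusMinus (mk (r.1 + 1) (2 * r.2.1 + if r.2.2 then 0 else 1)) false)
    (orthonormalFamily.comp (e := fun r : Fin 3 × Fin 4 × Bool =>
        ((r.1.castSucc, r.2.1.castLE (by norm_num)), r.2.2))
      fun r r' h => by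
        simp only [Prod.mk.injEq, Fin.ext_iff, Fin.val_castSucc, Fin.val_castLE] at h
        exact Prod.ext (Fin.ext h.1.1) (Prod.ext (Fin.ext h.1.2) h.2))
    (orthonormalFamily.comp (e := fun r : Fin 3 × Fin 4 × Bool =>
        ((r.1.succ, ⟨2 * r.2.1 + if r.2.2 then 0 else 1, by split_ifs <;> omega⟩), false))
      fun r r' h => by
        obtain ⟨j, n, σ⟩ := r
        obtain ⟨j', n', σ'⟩ := r'
        simp only [Prod.mk.injEq, Fin.ext_iff, Fin.val_succ] at h
        have h1 : j = j' := Fin.ext (by omega)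
        have h2 : n = n' ∧ σ = σ' := by
          cases σ <;> cases σ' <;> simp [Fin.ext_iff] at h ⊢ <;> omega
        rw [h1, h2.1, h2.2])
  exact ⟨V, fun j hj n hn σ => hV (⟨j, hj⟩, ⟨n, hn⟩, σ)⟩

theorem exists_finish : ∃ W : Matrix.unitaryGroup BinaryLabel ℂ, ∀ n < 8,
    (W : Matrix BinaryLabel BinaryLabel ℂ) *ᵥ plusMinus (mk 3 n) false = ket (mk 3 n false) := by
  obtain ⟨W, hW⟩ := exists_unitary_map (κ := Fin 8)
    (f := fun n => plusMinus (mk 3 n) false) (g := fun n => ket (mk 3 n false))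
    (orthonormalFamily.comp (e := fun n : Fin 8 => ((3, n), false)) fun n n' h => by simpa using h)
    (orthonormalFamily_ket fun n n' h =>
      Fin.ext (mk_inj (by norm_num) n.2 (by norm_num) n'.2 h).1.2)
  exact ⟨W, fun n hn => hW ⟨n, hn⟩⟩

/-- The interval number in layer j is f(x) / 2^(3 - j). The queried item is the last one of its left
half, or item `N - 1` if that is smaller, so the bit says whether f(x) lies in the left half. -/
theorem bisect_oracle {N : ℕ} {x : Fin N → Bool} (hx : x ∈ orderedInputs N) (hN : N ≤ 8)
    {V : Matrix.unitaryGroup BinaryLabel ℂ}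
    (hV : ∀ j < 3, ∀ n < 4, ∀ σ : Bool,
      (V : Matrix BinaryLabel BinaryLabel ℂ) *ᵥ plusMinus (mk j n) σ =
        plusMinus (mk (j + 1) (2 * n + if σ then 0 else 1)) false) {j : ℕ} (hj : j < 3) :
    (V : Matrix BinaryLabel BinaryLabel ℂ) *ᵥ (oracle (index N) x *ᵥ
      plusMinus (mk j (leftmostOne x / 2 ^ (3 - j))) false) =
      plusMinus (mk (j + 1) (leftmostOne x / 2 ^ (2 - j))) false := by
  have hf := leftmostOne_lt hx
  have hn : leftmostOne x / 2 ^ (3 - j) < 4 := by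
    interval_cases j <;> omega
  rw [oracle_mulVec_plusMinus _ x _ (by rw [index_mk_false]),
    index_mk_true N (hj.trans (by norm_num)) (hn.trans (by norm_num)), hV j hj _ hn]
  set i := min (leftmostOne x / 2 ^ (3 - j) * 2 ^ (3 - j) + 2 ^ (2 - j) - 1) (N - 1) with hi
  have hval : (2 * (leftmostOne x / 2 ^ (3 - j)) + if bit x i = true then 0 else 1) =
      leftmostOne x / 2 ^ (2 - j) := by
    simp only [bit_eq_true_iff hx (show i < N by omega)]
    split_ifs with h <;> interval_cases j <;> simp at hi ⊢ <;> omega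
  rw [hval]

end BinaryLabel

open BinaryLabel in
/-- Binary search on at most eight elements, with one query per bit of the answer. -/
theorem exists_binarySearch {N : ℕ} (hN : N ≤ 8) :
    ∃ A : Circuit, A.SearchesExactly N ∧ A.queries ≤ 3 := by
  obtain ⟨U, hU⟩ := exists_start
  obtain ⟨V, hV⟩ := exists_bisect
  obtain ⟨W, hW⟩ := exists_finish
  refine ⟨⟨BinaryLabel, inferInstance, inferInstance, 3,
    fun j => if j = 0 then U else if j = 3 then W * V else V, index N, mk 3 0 false,
    fun k => mk 3 k false⟩, ⟨fun k hk k' hk' h => ?_, fun x hx => ?_⟩, le_rfl⟩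
  · exact (mk_inj (by norm_num) (lt_of_lt_of_le hk hN) (by norm_num)
      (lt_of_lt_of_le hk' hN) h).1.2
  have hf := leftmostOne_lt hx
  have h0 := bisect_oracle hx hN hV (j := 0) (by norm_num)
  have h1 := bisect_oracle hx hN hV (j := 1) (by norm_num)
  have h2 := bisect_oracle hx hN hV (j := 2) (by norm_num)
  have hf8 : leftmostOne x / 2 ^ (3 - 0) = 0 := Nat.div_eq_of_lt (by norm_num; omega)
  rw [hf8] at h0
  let L : Matrix BinaryLabel BinaryLabel ℂ := V
  change ((W * V : Matrix.unitaryGroup BinaryLabel ℂ) : Matrix BinaryLabel BinaryLabel ℂ) *ᵥ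
    (oracle (index N) x *ᵥ (L *ᵥ (oracle (index N) x *ᵥ (L *ᵥ (oracle (index N) x *ᵥ
      ((U : Matrix BinaryLabel BinaryLabel ℂ) *ᵥ ket (mk 3 0 false))))))) = _
  rw [hU, h0, h1, Submonoid.coe_mul, ← Matrix.mulVec_mulVec, h2]
  simpa using hW (leftmostOne x) (by omega)

namespace PebbledTree

/-! ### Existence of fair and tight coverings -/

section Cover

variable {C : Type}

/-- A tight covering of the paths of a tree. -/
structure IsTightCovering (t : PebbledTree C) : Prop where
  one_per_path : ∀ a ∈ t.leafAddrs, ∀ c, ∃! k, k < a.length ∧ c ∈ t.peb (a.take k)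
  ancestors_le : ∀ v ∈ t.vertices, t.pAncestors v ≤ t.p v
  tight : ∀ v ∈ t.vertices, t.p v = t.pAncestors v ∨ t.pAncestors v = 0

theorem colorVertices_length_node [DecidableEq C] (P : Finset C) (l r : PebbledTree C) (c : C) :
    ((node P l r).colorVertices c).length = (l.colorVertices c).length +
      (if c ∈ P then 1 else 0) + (r.colorVertices c).length := by
  have hl : ((l.vertices.map (List.cons false)).filter
      fun v => c ∈ (node P l r).peb v).length = (l.colorVertices c).length := by
    rw [List.filter_map, List.length_map]; rfl
  have hr : ((r.vertices.map (List.cons true)).filter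
      fun v => c ∈ (node P l r).peb v).length = (r.colorVertices c).length := by
    rw [List.filter_map, List.length_map]; rfl
  rw [colorVertices, vertices, List.filter_append, List.filter_cons, List.length_append, hl]
  by_cases h : c ∈ P
  · rw [if_pos (decide_eq_true (p := c ∈ (node P l r).peb []) h), if_pos h, List.length_cons, hr]; omega
  · rw [if_neg fun h' => h (of_decide_eq_true (p := c ∈ (node P l r).peb []) h'), if_neg h, hr]; rfl

theorem numLeaves_node (P : Finset C) (l r : PebbledTree C) :
    (node P l r).numLeaves = l.numLeaves + r.numLeaves := by
  simp [numLeaves, leafAddrs]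

theorem pAncestors_node_cons (P : Finset C) (l r : PebbledTree C) (β : Bool) (v : List Bool) :
    (node P l r).pAncestors (β :: v) = P.card + (bif β then r else l).pAncestors v := by
  rw [pAncestors, List.length_cons, Finset.sum_range_succ', add_comm, pAncestors]
  cases β <;> simp [p, peb]

theorem existsUnique_node_empty {l r : PebbledTree C} {c : C} {β : Bool} {a : List Bool}
    (h : ∃! k, k < a.length ∧ c ∈ (bif β then r else l).peb (a.take k)) :
    ∃! k, k < (β :: a).length ∧ c ∈ (node ∅ l r).peb ((β :: a).take k) := by
  obtain ⟨k, hk, hu⟩ := h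
  refine ⟨k + 1, ?_, ?_⟩
  · cases β <;> simpa [peb] using hk
  · rintro (_ | j) hj
    · simp [peb] at hj
    · rw [hu j (by cases β <;> simpa [peb] using hj)]

/-- A root without pebbles changes neither the colors on a path nor the pebble counts above a
vertex. -/
theorem IsTightCovering.node_empty {l r : PebbledTree C} (hl : l.IsTightCovering)
    (hr : r.IsTightCovering) : (node ∅ l r).IsTightCovering := by
  refine ⟨fun a ha c => ?_, fun v hv => ?_, fun v hv => ?_⟩
  · rcases List.mem_append.1 ha with h | h <;> obtain ⟨a, ha', rfl⟩ := List.mem_map.1 h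
    · exact existsUnique_node_empty (hl.one_per_path a ha' c)
    · exact existsUnique_node_empty (hr.one_per_path a ha' c)
  · rcases v with _ | ⟨_ | _, v⟩
    · simp [pAncestors]
    · rw [pAncestors_node_cons]
      simpa [p, peb] using hl.ancestors_le v (by simpa [vertices] using hv)
    · rw [pAncestors_node_cons]
      simpa [p, peb] using hr.ancestors_le v (by simpa [vertices] using hv)
  · rcases v with _ | ⟨_ | _, v⟩
    · simp [pAncestors]
    · rw [pAncestors_node_cons]
      simpa [p, peb] using hl.tight v (by simpa [vertices] using hv)
    · rw [pAncestors_node_cons]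
      simpa [p, peb] using hr.tight v (by simpa [vertices] using hv)

/-! ### Complete trees with pebbles depending on the depth -/

/-- The complete binary tree of height `h` with pebbles `P (d + i)` on all vertices of
depth `i`. -/
def complete (P : ℕ → Finset C) : ℕ → ℕ → PebbledTree C
  | 0, _ => leaf
  | h + 1, d => node (P d) (complete P h (d + 1)) (complete P h (d + 1))

theorem numLeaves_complete (P : ℕ → Finset C) (h d : ℕ) : (complete P h d).numLeaves = 2 ^ h := by
  induction h generalizing d with
  | zero => simp [complete, numLeaves, leafAddrs]
  | succ h ih => rw [complete, numLeaves_node, ih, pow_succ]; omega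

theorem length_of_mem_leafAddrs_complete {P : ℕ → Finset C} {h d : ℕ} {a : List Bool}
    (ha : a ∈ (complete P h d).leafAddrs) : a.length = h := by
  induction h generalizing d a with
  | zero => simpa [complete, leafAddrs] using ha
  | succ h ih =>
    rcases List.mem_append.1 ha with h' | h' <;> obtain ⟨b, hb, rfl⟩ := List.mem_map.1 h' <;>
      simp [ih hb]

theorem peb_complete (P : ℕ → Finset C) {h d : ℕ} {v : List Bool} (hv : v.length < h) :
    (complete P h d).peb v = P (d + v.length) := by
  induction h generalizing d v with
  | zero => omega
  | succ h ih =>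
    rcases v with _ | ⟨_ | _, v⟩
    · simp [complete, peb]
    all_goals
      rw [complete, peb, ih (by simpa using hv)]
      congr 1
      simp; omega

theorem length_lt_of_mem_vertices_complete {P : ℕ → Finset C} {h d : ℕ} {v : List Bool}
    (hv : v ∈ (complete P h d).vertices) : v.length < h := by
  obtain ⟨a, ha, hva⟩ := (isAddr_child_iff _ v false).2 hv
  have := hva.length_le
  rw [length_of_mem_leafAddrs_complete ha] at this
  simpa using this

theorem colorVertices_length_complete [DecidableEq C] (P : ℕ → Finset C) (h d : ℕ) (c : C) :
    ((complete P h d).colorVertices c).length =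
      ∑ i ∈ Finset.range h, if c ∈ P (d + i) then 2 ^ i else 0 := by
  induction h generalizing d with
  | zero => simp [complete, colorVertices, vertices]
  | succ h ih =>
    rw [complete, colorVertices_length_node, ih, Finset.sum_range_succ', add_right_comm,
      ← Finset.sum_add_distrib]
    congr 1
    · refine Finset.sum_congr rfl fun i _ => ?_
      rw [show d + 1 + i = d + (i + 1) by omega, pow_succ]
      split_ifs <;> omega
-- All paths look alike, so the conditions reduce to the levels: they partition the colors, and each
-- one after the first doubles the number of colors met so far.
theorem isTightCovering_complete {P : ℕ → Finset C} {h : ℕ}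
    (h1 : ∀ c, ∃! i, i < h ∧ c ∈ P i)
    (h2 : ∀ i, i + 1 < h → (P (i + 1)).card = ∑ j ∈ Finset.range (i + 1), (P j).card) :
    (complete P h 0).IsTightCovering := by
  have hanc : ∀ v ∈ (complete P h 0).vertices,
      (complete P h 0).p v = (complete P h 0).pAncestors v ∨
        (complete P h 0).pAncestors v = 0 := by
    intro v hv
    have hlt := length_lt_of_mem_vertices_complete hv
    have ha : (complete P h 0).pAncestors v = ∑ j ∈ Finset.range v.length, (P j).card := by
      refine Finset.sum_congr rfl fun k hk => ?_
      have hk' : (v.take k).length = k := by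
        rw [List.length_take, min_eq_left (Finset.mem_range.1 hk).le]
      rw [p, peb_complete P (by rw [hk']; exact (Finset.mem_range.1 hk).trans hlt), hk', zero_add]
    rw [p, peb_complete P hlt, ha, zero_add]
    rcases hv' : v.length with _ | i
    · simp
    · exact Or.inl (h2 i (by omega))
  refine ⟨fun a ha c => ?_, fun v hv => ?_, hanc⟩
  · rw [length_of_mem_leafAddrs_complete ha]
    refine (existsUnique_congr fun k => and_congr_right fun hk => ?_).2 (h1 c)
    have hk' : (a.take k).length = k := by
      rw [List.length_take, length_of_mem_leafAddrs_complete ha, min_eq_left hk.le]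
    rw [peb_complete P (by rw [hk']; exact hk), hk', zero_add]
  · rcases hanc v hv with h | h
    · exact h.ge
    · rw [h]; exact Nat.zero_le _

/-! ### Joining trees into fair coverings -/

variable [DecidableEq C]

/-- A nonempty list of trees can be joined at bare vertices. -/
theorem exists_join (t : PebbledTree C) (ts : List (PebbledTree C))
    (h : ∀ t' ∈ t :: ts, t'.IsTightCovering) :
    ∃ t' : PebbledTree C, t'.IsTightCovering ∧ t'.numLeaves = ((t :: ts).map numLeaves).sum ∧
      ∀ c, (t'.colorVertices c).length = ((t :: ts).map fun t => (t.colorVertices c).length).sum := by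
  induction ts generalizing t with
  | nil => exact ⟨t, h t (by simp), by simp, by simp⟩
  | cons t₁ ts ih =>
    obtain ⟨t', h1, h2, h3⟩ := ih t₁ fun t' ht' => h t' (List.mem_cons_of_mem _ ht')
    refine ⟨node ∅ t t', (h t (by simp)).node_empty h1, ?_, fun c => ?_⟩
    · rw [numLeaves_node, h2, List.map_cons (a := t), List.sum_cons]
    · rw [colorVertices_length_node, h3, List.map_cons (a := t), List.sum_cons]
      simp

/-- There are trees with tight coverings and `r` leaves in total, in which every color is used
`X` times in total. -/
def HasFairForest (C : Type) [DecidableEq C] (r X : ℕ) : Prop :=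
  ∃ ts : List (PebbledTree C), (∀ t ∈ ts, t.IsTightCovering) ∧
    (ts.map numLeaves).sum = r ∧ ∀ c, (ts.map fun t => (t.colorVertices c).length).sum = X

theorem HasFairForest.zero : HasFairForest C 0 0 := ⟨[], by simp⟩

theorem HasFairForest.add {r X r' X' : ℕ} (h : HasFairForest C r X) (h' : HasFairForest C r' X') :
    HasFairForest C (r + r') (X + X') := by
  obtain ⟨ts, h1, h2, h3⟩ := h
  obtain ⟨ts', h1', h2', h3'⟩ := h'
  refine ⟨ts ++ ts', ?_, by simp [h2, h2'], fun c => by simp [h3, h3']⟩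
  intro t ht
  rcases List.mem_append.1 ht with h | h
  exacts [h1 t h, h1' t h]

theorem HasFairForest.mul {r X : ℕ} (h : HasFairForest C r X) (d : ℕ) :
    HasFairForest C (d * r) (d * X) := by
  induction d with
  | zero => simpa using HasFairForest.zero
  | succ d ih => rw [Nat.succ_mul, Nat.succ_mul]; exact ih.add h

theorem HasFairForest.exists_covering {r X : ℕ} (h : HasFairForest C r X) (hr : 0 < r) {N' : ℕ}
    (hX : X ≤ N') : ∃ t : PebbledTree C, t.numLeaves = r ∧ t.IsFairTightCovering N' := by
  obtain ⟨_ | ⟨t, ts⟩, h1, h2, h3⟩ := h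
  · simp at h2; omega
  · obtain ⟨t', ht', h2', h3'⟩ := exists_join t ts h1
    have hcount : ∀ c, (t'.colorVertices c).length = X := fun c => (h3' c).trans (h3 c)
    exact ⟨t', h2'.trans h2, ht'.one_per_path, ht'.ancestors_le, fun c => (hcount c).trans_le hX,
      fun c c' => (hcount c).trans (hcount c').symm, ht'.tight⟩

end Cover

/-! ### Rotated complete trees -/

/-- The colors at depth `i` of the `b`-th rotation. -/
def levelColors (s m b i : ℕ) : Finset (Fin (2 ^ s)) :=
  Finset.univ.filter fun c => Nat.size ((c + b) % 2 ^ m) = i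

/-- Residues of binary size i + 1 fill [2^i, 2^(i+1)), and those of size at most i fill [0, 2^i).
Translation by 2^i matches the two sets. -/
theorem card_levelColors_succ {s m b i : ℕ} (hm : m ≤ s) (hi : i + 1 ≤ m) :
    (levelColors s m b (i + 1)).card = ∑ j ∈ Finset.range (i + 1), (levelColors s m b j).card := by
  have h1 : ∑ j ∈ Finset.range (i + 1), (levelColors s m b j).card =
      (Finset.univ.filter fun c : Fin (2 ^ s) => (c + b) % 2 ^ m < 2 ^ i).card := by
    rw [← Finset.card_biUnion]
    · congr 1
      ext c
      simp [levelColors, ← Nat.size_le]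
    · intro j _ k _ hjk
      rw [Function.onFun, Finset.disjoint_left]
      intro c hc hc'
      simp only [levelColors, Finset.mem_filter] at hc hc'
      exact hjk (hc.2.symm.trans hc'.2)
  rw [h1]
  symm
  have hdvd : 2 ^ m ∣ 2 ^ s := pow_dvd_pow 2 hm
  have hlt : 2 ^ i < 2 ^ s := Nat.pow_lt_pow_right (by norm_num) (by omega)
  have : NeZero (2 ^ s) := ⟨by positivity⟩
  -- Addition of colors wraps around at 2^s, which is compatible with residues modulo 2^m because
  -- 2^m divides 2^s.
  refine Finset.card_equiv (Equiv.addRight (⟨2 ^ i, hlt⟩ : Fin (2 ^ s))) fun c => ?_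
  have hsum : (((c + ⟨2 ^ i, hlt⟩ : Fin (2 ^ s)) : ℕ) + b) % 2 ^ m =
      ((c + b) % 2 ^ m + 2 ^ i) % 2 ^ m := by
    rw [Fin.val_add, Nat.mod_add_mod, Nat.add_mod, Nat.mod_mod_of_dvd _ hdvd, ← Nat.add_mod]
    congr 1
    simp only
    ring
  simp only [levelColors, Finset.mem_filter, Finset.mem_univ, true_and, Equiv.coe_addRight, hsum]
  have hsize : ∀ n, Nat.size n = i + 1 ↔ 2 ^ i ≤ n ∧ n < 2 ^ (i + 1) := by
    intro n
    rw [← Nat.size_le, ← Nat.lt_size]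
    omega
  rw [hsize]
  have hle : 2 ^ (i + 1) ≤ 2 ^ m := Nat.pow_le_pow_right (by norm_num) hi
  have hmod : (c + b) % 2 ^ m < 2 ^ m := Nat.mod_lt _ (by positivity)
  rw [pow_succ] at hle ⊢
  generalize ((c : ℕ) + b) % 2 ^ m = r at hmod ⊢
  rcases lt_or_ge (r + 2 ^ i) (2 ^ m) with h | h
  · rw [Nat.mod_eq_of_lt h]
    omega
  · rw [Nat.mod_eq_sub_mod h, Nat.mod_eq_of_lt (by omega)]
    omega

theorem isTightCovering_complete_levelColors {s m b : ℕ} (hm : m ≤ s) :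
    (complete (levelColors s m b) (m + 1) 0).IsTightCovering := by
  refine isTightCovering_complete (fun c => ?_) fun i hi =>
    card_levelColors_succ hm (Nat.lt_succ_iff.1 hi)
  refine ⟨Nat.size ((c + b) % 2 ^ m),
    ⟨Nat.lt_succ_of_le (Nat.size_le.2 (Nat.mod_lt _ (by positivity))), ?_⟩, ?_⟩
  · simp [levelColors]
  · rintro j ⟨-, hj⟩
    simp only [levelColors, Finset.mem_filter, Finset.mem_univ, true_and] at hj
    exact hj.symm

/-- The number of pebbles of each color on all rotations of a complete tree together. -/
def rotationCount (m : ℕ) : ℕ := ∑ n ∈ Finset.range (2 ^ m), 2 ^ Nat.size n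

/-- The 2^m numbers in [2^m, 2^(m+1)) all have size m + 1, so each step adds 2·4^m to the count.
Compared with 2·4^m leaves, this is the ratio of one third that yields log₃. -/
theorem three_mul_rotationCount (m : ℕ) : 3 * rotationCount m = 1 + 2 * 4 ^ m := by
  induction m with
  | zero => simp [rotationCount]
  | succ m ih =>
    have h : rotationCount (m + 1) = rotationCount m + 2 ^ m * 2 ^ (m + 1) := by
      rw [rotationCount, rotationCount, Finset.range_eq_Ico, Finset.range_eq_Ico,
        ← Finset.sum_Ico_consecutive _ (Nat.zero_le (2 ^ m))
          (Nat.pow_le_pow_right (by norm_num) m.le_succ)]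
      congr 1
      rw [Finset.sum_congr rfl fun n hn => ?_, Finset.sum_const, Nat.card_Ico, pow_succ,
        smul_eq_mul]
      · congr 1
        omega
      · rw [Finset.mem_Ico, ← Nat.lt_size, ← Nat.size_le] at hn
        rw [show Nat.size n = m + 1 by omega, pow_succ]
    rw [h, mul_add, ih, ← pow_add, show 4 = 2 ^ 2 by norm_num, ← pow_mul, ← pow_mul,
      show m + (m + 1) = 2 * m + 1 by omega, show 2 * (m + 1) = 2 * m + 2 by omega]
    ring

theorem sum_rotations (c n : ℕ) (F : ℕ → ℕ) :
    ∑ b ∈ Finset.range n, F ((c + b) % n) = ∑ r ∈ Finset.range n, F r := by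
  have h1 : ∑ b ∈ Finset.range n, F ((c + b) % n) = ∑ x ∈ Finset.Ico c (c + n), F (x % n) := by
    rw [Finset.sum_Ico_eq_sum_range, Nat.add_sub_cancel_left]
  have h2 := congrArg (fun M => (Multiset.map F M).sum) (Nat.multiset_Ico_map_mod c n)
  simp only [Multiset.map_map] at h2
  rw [h1]
  exact h2

/-- A color at depth i is used 2^i times in a single tree, which is unfair. Over all 2^m rotations
every color runs through every residue once, so the totals agree. -/
theorem hasFairForest_rotations {s m : ℕ} (hm : m ≤ s) :
    HasFairForest (Fin (2 ^ s)) (2 * 4 ^ m) (rotationCount m) := by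
  refine ⟨(List.range (2 ^ m)).map fun b => complete (levelColors s m b) (m + 1) 0, ?_, ?_, ?_⟩
  · intro t ht
    obtain ⟨b, -, rfl⟩ := List.mem_map.1 ht
    exact isTightCovering_complete_levelColors hm
  · simp only [List.map_map, Function.comp_def, numLeaves_complete, List.map_const',
      List.length_range, List.sum_replicate, smul_eq_mul]
    rw [← pow_add, show 4 = 2 ^ 2 by norm_num, ← pow_mul, ← pow_succ']
    congr 1
    omega
  · intro c
    have h : ∀ b, ((complete (levelColors s m b) (m + 1) 0).colorVertices c).length =
        2 ^ Nat.size (((c : ℕ) + b) % 2 ^ m) := by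
      intro b
      rw [colorVertices_length_complete, Finset.sum_eq_single (Nat.size (((c : ℕ) + b) % 2 ^ m))]
      · rw [if_pos]
        simp [levelColors]
      · intro i _ hi
        rw [if_neg]
        simpa [levelColors] using hi.symm
      · intro h
        exact absurd (Finset.mem_range.2
          (Nat.lt_succ_of_le (Nat.size_le.2 (Nat.mod_lt _ (by positivity))))) h
    simp only [List.map_map, Function.comp_def, h]
    rw [rotationCount, ← sum_rotations c (2 ^ m) fun r => 2 ^ Nat.size r]
    rfl

/-- Expand q in base 4. A digit d at 4^m takes d rotation forests with d(1 + 2·4^m)/3 pebbles of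
each color. The excess over a third of their leaves is d/3, at most one for each of the k digits. -/
theorem exists_hasFairForest {s k : ℕ} (hk : k ≤ s + 1) {q : ℕ} (hq : q < 4 ^ k) :
    ∃ X, HasFairForest (Fin (2 ^ s)) (2 * q) X ∧ 3 * X ≤ 2 * q + 3 * k := by
  induction k generalizing q with
  | zero =>
    obtain rfl : q = 0 := by simpa using hq
    exact ⟨0, HasFairForest.zero, by simp⟩
  | succ k ih =>
    obtain ⟨X, hX, hle⟩ := ih (by omega) (Nat.mod_lt q (by positivity : 0 < 4 ^ k))
    have hd : q / 4 ^ k < 4 := by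
      rw [Nat.div_lt_iff_lt_mul (by positivity), ← pow_succ']
      exact hq
    have hadd := ((hasFairForest_rotations (show k ≤ s by omega)).mul (q / 4 ^ k)).add hX
    have hq' : q / 4 ^ k * 4 ^ k + q % 4 ^ k = q := Nat.div_add_mod' q _
    have h3 := three_mul_rotationCount k
    refine ⟨q / 4 ^ k * rotationCount k + X, ?_, ?_⟩
    · rwa [show q / 4 ^ k * (2 * 4 ^ k) + 2 * (q % 4 ^ k) = 2 * q by
        rw [mul_left_comm, ← mul_add, hq']] at hadd
    · calc 3 * (q / 4 ^ k * rotationCount k + X)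
          = q / 4 ^ k * (3 * rotationCount k) + 3 * X := by ring
        _ = q / 4 ^ k + 2 * (q / 4 ^ k * 4 ^ k) + 3 * X := by rw [h3]; ring
        _ ≤ 2 * q + 3 * (k + 1) := by omega

/-- **Existence of fair and tight coverings.** -/
theorem exists_isFairTightCovering {L : ℕ} (hL : Even L) (hL' : 0 < L) :
    ∃ t : PebbledTree (Fin (numColors L)), t.numLeaves = L ∧
      t.IsFairTightCovering (pebbleBound L) := by
  obtain ⟨q, rfl⟩ := hL.two_dvd
  have hq : q ≠ 0 := by omega
  have hs : 2 * q / 2 = q := by omega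
  obtain ⟨X, hX, hle⟩ := exists_hasFairForest (s := Nat.log 4 (2 * q / 2)) le_rfl
    (by rw [hs]; exact Nat.lt_pow_succ_log_self (by norm_num) q)
  refine hX.exists_covering hL' (Nat.le_floor ?_)
  set s := Nat.log 4 (2 * q / 2) with hsdef
  -- The s + 1 digits of q = L/2 may cost s + 1 extra pebbles, which log₂ L covers since 2^(s+1) ≤
  -- 2·4^s ≤ L.
  have hpow : 2 ^ (s + 1) ≤ 2 * q := by
    have h4 : 4 ^ s ≤ q := by
      rw [hsdef, hs]
      exact Nat.pow_log_le_self 4 hq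
    have h2 : 2 ^ s ≤ 4 ^ s := Nat.pow_le_pow_left (by norm_num) s
    rw [pow_succ]
    omega
  have hlog : ((s + 1 : ℕ) : ℝ) ≤ Real.logb 2 ((2 * q : ℕ) : ℝ) := by
    rw [Real.le_logb_iff_rpow_le (by norm_num) (by exact_mod_cast hL'), Real.rpow_natCast]
    exact_mod_cast hpow
  have hle' : 3 * (X : ℝ) ≤ ((2 * q : ℕ) : ℝ) + 3 * ((s + 1 : ℕ) : ℝ) := by exact_mod_cast hle
  linarith

end PebbledTree

theorem star_dotProduct_swap {ι : Type} [Fintype ι] (v w : ι → ℂ) :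
    star v ⬝ᵥ w = star (star w ⬝ᵥ v) := by
  rw [Matrix.star_dotProduct]

namespace PebbledTree

/-! ### The image of the last operator is orthonormal -/

variable {C ι : Type} [DecidableEq ι] [Fintype ι] {t : PebbledTree C} {s : ℕ → ι}

/-- The image of a pebbled vertex under the last operator: `Φ` of a child if there are no
pebbles on the parent, and the difference of the children otherwise. -/
def lastState (t : PebbledTree C) (s : ℕ → ι) (v : List Bool) (β : Bool) : ι → ℂ :=
  open Classical in
  if t.ParentBare v then Phi t s (v ++ [!β])
  else (((√2)⁻¹ : ℝ) : ℂ) • (Phi t s (v ++ [true]) - Phi t s (v ++ [false]))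

/-- The state Φ_u overlaps equally with Φ of both children of `w`, so it is orthogonal to their
difference. -/
theorem star_Phi_dotProduct_difference {u w : List Bool}
    (hs : Set.InjOn s (Set.Iio t.numLeaves)) (hw : w ∈ t.vertices) (h : u <+: w) :
    star (Phi t s u) ⬝ᵥ
      ((((√2)⁻¹ : ℝ) : ℂ) • (Phi t s (w ++ [true]) - Phi t s (w ++ [false]))) = 0 := by
  rw [dotProduct_smul, dotProduct_sub,
    star_Phi_dotProduct_of_prefix hs ((isAddr_child_iff t w true).2 hw)
      (h.trans (List.prefix_append _ _)),
    star_Phi_dotProduct_of_prefix hs ((isAddr_child_iff t w false).2 hw)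
      (h.trans (List.prefix_append _ _))]
  simp

theorem leftOf_append {u w : List Bool} (h : LeftOf u w) (a b : List Bool) :
    LeftOf (u ++ a) (w ++ b) :=
  h.of_prefix (List.prefix_append _ _) (List.prefix_append _ _)

theorem star_lastState_of_leftOf (hs : Set.InjOn s (Set.Iio t.numLeaves)) {v w : List Bool}
    (h : LeftOf v w ∨ LeftOf w v) (β γ : Bool) :
    star (lastState t s v β) ⬝ᵥ lastState t s w γ = 0 := by
  have h0 : ∀ x y : Bool, star (Phi t s (v ++ [x])) ⬝ᵥ Phi t s (w ++ [y]) = 0 := fun x y =>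
    star_Phi_dotProduct_of_leftOf hs (h.imp (fun h => leftOf_append h _ _)
      fun h => leftOf_append h _ _)
  unfold lastState
  split_ifs <;> simp [star_smul, sub_dotProduct, dotProduct_sub, smul_dotProduct, h0]

/-- Each child of `v` either has `w` in its subtree, where the two overlaps cancel, or has a subtree
disjoint from that of `w`. -/
theorem star_lastState_of_prefix (hs : Set.InjOn s (Set.Iio t.numLeaves)) {v w : List Bool}
    (hw : w ∈ t.vertices) (hb : ¬ t.ParentBare w) (h : v <+: w) (hne : v ≠ w) (β γ : Bool) :
    star (lastState t s v β) ⬝ᵥ lastState t s w γ = 0 := by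
  have h0 : ∀ x : Bool, star (Phi t s (v ++ [x])) ⬝ᵥ
      ((((√2)⁻¹ : ℝ) : ℂ) • (Phi t s (w ++ [true]) - Phi t s (w ++ [false]))) = 0 := by
    intro x
    obtain ⟨y, hy⟩ := exists_child_prefix h hne
    rcases eq_or_ne x y with rfl | hxy
    · exact star_Phi_dotProduct_difference hs hw hy
    · have h1 : ∀ z, star (Phi t s (v ++ [x])) ⬝ᵥ Phi t s (w ++ [z]) = 0 := by
        intro z
        have hyz : v ++ [y] <+: w ++ [z] := hy.trans (List.prefix_append _ _)
        refine star_Phi_dotProduct_of_leftOf hs ?_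
        cases x <;> cases y <;> simp at hxy
        · exact Or.inl ((leftOf_children v).of_prefix List.prefix_rfl hyz)
        · exact Or.inr ((leftOf_children v).of_prefix hyz List.prefix_rfl)
      rw [dotProduct_smul, dotProduct_sub, h1, h1]
      simp
  have hw' : lastState t s w γ =
      (((√2)⁻¹ : ℝ) : ℂ) • (Phi t s (w ++ [true]) - Phi t s (w ++ [false])) := if_neg hb
  rw [hw', lastState]
  split_ifs
  · exact h0 _
  · rw [star_smul, smul_dotProduct, star_sub, sub_dotProduct, h0, h0]
    simp

theorem star_Phi_children (hs : Set.InjOn s (Set.Iio t.numLeaves)) {v : List Bool}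
    (hv : v ∈ t.vertices) (x y : Bool) :
    star (Phi t s (v ++ [x])) ⬝ᵥ Phi t s (v ++ [y]) = if x = y then 1 else 0 := by
  split_ifs with h
  · subst h
    rw [star_Phi_dotProduct_of_prefix hs ((isAddr_child_iff t v x).2 hv) List.prefix_rfl]
    simp
  · refine star_Phi_dotProduct_of_leftOf hs ?_
    cases x <;> cases y <;> simp at h
    · exact Or.inl (leftOf_children v)
    · exact Or.inr (leftOf_children v)

theorem star_lastState_self (hs : Set.InjOn s (Set.Iio t.numLeaves)) {v : List Bool}
    (hv : v ∈ t.vertices) {β γ : Bool} (h : t.ParentBare v ∨ β = γ) :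
    star (lastState t s v β) ⬝ᵥ lastState t s v γ = if β = γ then 1 else 0 := by
  unfold lastState
  split_ifs with hb h' h'
  · rw [star_Phi_children hs hv, if_pos (by rw [h'])]
  · rw [star_Phi_children hs hv, if_neg (by simpa using h')]
  · have h2 : (((√2)⁻¹ : ℝ) : ℂ) * (((√2)⁻¹ : ℝ) : ℂ) = 2⁻¹ := by
      rw [← Complex.ofReal_mul, ← mul_inv, Real.mul_self_sqrt (by norm_num)]
      norm_num
    simp only [star_smul, star_sub, sub_dotProduct, dotProduct_sub, smul_dotProduct,
      dotProduct_smul, star_Phi_children hs hv, Complex.star_def, Complex.conj_ofReal, smul_eq_mul]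
    simp only [if_true, Bool.false_eq_true, Bool.true_eq_false, if_false, mul_one, sub_zero,
      zero_sub, sub_neg_eq_add, mul_neg, mul_add, h2]
    norm_num
  · exact absurd (h.resolve_left hb) h'

variable [DecidableEq C] {N' : ℕ}

theorem IsFairTightCovering.not_parentBare (hc : t.IsFairTightCovering N') {v w : List Bool}
    (hv : 0 < t.p v) (hw : w ∈ t.vertices) (h : v <+: w) (hne : v ≠ w) : ¬ t.ParentBare w := by
  have haddr := (isAddr_child_iff t w false).2 hw
  have hwt : (w ++ [false]).take w.length = w := by simp
  have hlen : v.length < w.length :=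
    lt_of_le_of_ne h.length_le fun h' => hne (h.eq_of_length h')
  have hiff := parentBare_iff hc haddr (m := w.length) (by simp)
  rw [hwt] at hiff
  rw [hiff, pAncestors, Finset.sum_eq_zero_iff]
  intro h0
  have := h0 v.length (Finset.mem_range.2 hlen)
  rw [← List.prefix_iff_eq_take.1 h] at this
  omega

/-- Incomparable vertices have images with disjoint supports. Of two comparable pebbled vertices the
lower one has pebbles above it, so its image is a difference, orthogonal to the image of the upper
one. The index set keeps both bits where the parent is bare and only `false` elsewhere, where the
image does not depend on the bit. -/
theorem IsFairTightCovering.orthonormalFamily_lastState (hc : t.IsFairTightCovering N')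
    (hs : Set.InjOn s (Set.Iio t.numLeaves)) :
    OrthonormalFamily fun r : {r : List Bool × Bool //
      0 < t.p r.1 ∧ (t.ParentBare r.1 ∨ r.2 = false)} => lastState t s r.1.1 r.1.2 := by
  refine ⟨fun ⟨⟨v, β⟩, hv, _⟩ => ?_, fun ⟨⟨v, β⟩, hv, hβ⟩ ⟨⟨w, γ⟩, hw, hγ⟩ hne => ?_⟩
  · exact (star_lastState_self hs (mem_vertices_of_p_pos hv) (Or.inr rfl)).trans (if_pos rfl)
  · simp only at hv hβ hw hγ ⊢
    have hvm := mem_vertices_of_p_pos hv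
    have hwm := mem_vertices_of_p_pos hw
    rcases eq_or_ne v w with rfl | hvw
    · have hβγ : β ≠ γ := by
        rintro rfl
        exact hne rfl
      rw [star_lastState_self hs hvm, if_neg hβγ]
      rcases hβ with h | h
      · exact Or.inl h
      · rcases hγ with h' | h'
        · exact Or.inl h'
        · exact absurd (h.trans h'.symm) hβγ
    · rcases prefix_or_leftOf v w with h | h | h
      · exact star_lastState_of_prefix hs hwm (hc.not_parentBare hv hwm h hvw) h hvw _ _
      · rw [star_dotProduct_swap,
          star_lastState_of_prefix hs hvm (hc.not_parentBare hw hvm h hvw.symm) h hvw.symm,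
          star_zero]
      · exact star_lastState_of_leftOf hs h _ _

end PebbledTree

/-! ### Existence of the circuit for one level of the recursion -/

namespace StepCircuit

open PebbledTree

variable {C : Type}

/-- Labels of the basis states: the registers of the recursive search and the color, the
vertices with one additional bit, and the leaves. -/
abbrev Label (C : Type) (t : PebbledTree C) (A' : Circuit) : Type :=
  (A'.ι × C) ⊕ (Fin (t.vertices.length + 1) × Bool) ⊕ Fin (t.numLeaves + 1)

variable {t : PebbledTree C} {A' : Circuit}

/-- The label of a vertex together with one bit. -/
def cell (t : PebbledTree C) (A' : Circuit) (v : List Bool) (β : Bool) : Label C t A' :=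
  Sum.inr (Sum.inl (Fin.ofNat _ (t.vertices.idxOf v), β))

/-- The label of a leaf. -/
def leafLabel (t : PebbledTree C) (A' : Circuit) (ℓ : ℕ) : Label C t A' :=
  Sum.inr (Sum.inr (Fin.ofNat _ ℓ))

theorem cell_inj {v w : List Bool} {β γ : Bool} (hv : v ∈ t.vertices) (hw : w ∈ t.vertices)
    (h : cell t A' v β = cell t A' w γ) : v = w ∧ β = γ := by
  simp only [cell, Sum.inr.injEq, Sum.inl.injEq, Prod.mk.injEq, Fin.ext_iff, Fin.val_ofNat] at h
  have h1 := List.idxOf_lt_length_of_mem hv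
  have h2 := List.idxOf_lt_length_of_mem hw
  rw [Nat.mod_eq_of_lt (by omega), Nat.mod_eq_of_lt (by omega)] at h
  exact ⟨(List.idxOf_inj hv).1 h.1, h.2⟩

theorem leafLabel_injOn : Set.InjOn (leafLabel t A') (Set.Iio t.numLeaves) := by
  intro a ha b hb h
  rw [Set.mem_Iio] at ha hb
  simp only [leafLabel, Sum.inr.injEq, Fin.ext_iff, Fin.val_ofNat] at h
  rwa [Nat.mod_eq_of_lt (by omega), Nat.mod_eq_of_lt (by omega)] at h

/-- The index registers. -/
def index [DecidableEq C] (N M : ℕ) : Label C t A' → ℕ :=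
  open Classical in
  Sum.elim (fun r => if A'.idx r.1 < M then subIndex N t r.2 (A'.idx r.1) else N)
    (Sum.elim (fun r =>
      if r.2 = false ∧ t.ParentBare (t.vertices.getD r.1 []) then N
      else t.rightmostLeaf (t.vertices.getD r.1 [] ++ [false])) fun _ => N)

theorem index_cell [DecidableEq C] (N M : ℕ) {v : List Bool} (hv : v ∈ t.vertices) (β : Bool) :
    index N M (cell t A' v β) = open Classical in
      if β = false ∧ t.ParentBare v then N else t.rightmostLeaf (v ++ [false]) := by
  have h1 := List.idxOf_lt_length_of_mem hv
  have h2 : t.vertices.getD (Fin.ofNat (t.vertices.length + 1) (t.vertices.idxOf v) : ℕ) [] = v := by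
    rw [Fin.val_ofNat, Nat.mod_eq_of_lt (by omega), List.getD_eq_getElem _ _ h1,
      List.getElem_idxOf h1]
  simp only [index, cell, Sum.elim_inr, Sum.elim_inl]
  rw [h2]

variable [Fintype C] [DecidableEq C] {N' : ℕ}

theorem exists_prep [Nonempty C] : ∃ U : Matrix.unitaryGroup (Label C t A') ℂ,
    (U : Matrix (Label C t A') (Label C t A') ℂ) *ᵥ ket (leafLabel t A' 0) =
      (((√(Fintype.card C))⁻¹ : ℝ) : ℂ) • ∑ c, ket (Sum.inl (A'.start, c)) := by
  obtain ⟨U, hU⟩ := exists_unitary_map (κ := Unit) (f := fun _ => ket (leafLabel t A' 0))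
    (orthonormalFamily_ket fun _ _ _ => rfl)
    (orthonormalFamily_uniform (S := fun _ => (Finset.univ : Finset C))
      (e := fun _ c => Sum.inl (A'.start, c)) (fun _ => Finset.univ_nonempty)
      fun a b c _ d _ h => ⟨rfl, by simpa using h⟩)
  exact ⟨U, hU ()⟩

theorem exists_lift (j : ℕ) : ∃ U : Matrix.unitaryGroup (Label C t A') ℂ, ∀ b c,
    (U : Matrix (Label C t A') (Label C t A') ℂ) *ᵥ ket (Sum.inl (b, c)) =
      ∑ b', (A'.U j : Matrix A'.ι A'.ι ℂ) b' b • ket (Sum.inl (b', c)) := by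
  obtain ⟨U, hU⟩ := exists_unitary_map (κ := A'.ι × C)
    (f := fun r => (ket (Sum.inl r) : Label C t A' → ℂ))
    (orthonormalFamily_ket Sum.inl_injective)
    (orthonormalFamily_columns (ι := Label C t A') (fun _ : C => A'.U j)
      (fun b c => Sum.inl (b, c)) fun b c b' c' h => by simpa using h)
  exact ⟨U, fun b c => hU (b, c)⟩

/-- The position in the list of a color determines the vertex, and the answer states of the
recursive search are distinct. So different vertices are sent to superpositions of disjoint sets of
basis states. -/
theorem exists_coloring {M : ℕ} (hA' : Set.InjOn A'.ans (Set.Iio M))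
    (hc : t.IsFairTightCovering N') (hM : N' ≤ M) :
    ∃ U : Matrix.unitaryGroup (Label C t A') ℂ, ∀ v, 0 < t.p v →
      (U : Matrix (Label C t A') (Label C t A') ℂ) *ᵥ ket (cell t A' v false) =
        (((√(t.p v))⁻¹ : ℝ) : ℂ) •
          ∑ c ∈ t.peb v, ket (Sum.inl (A'.ans ((t.colorVertices c).idxOf v), c)) := by
  obtain ⟨U, hU⟩ := exists_unitary_map (κ := {v // 0 < t.p v})
    (f := fun v => ket (cell t A' v false))
    (orthonormalFamily_ket fun v w h => Subtype.ext (cell_inj (mem_vertices_of_p_pos v.2)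
      (mem_vertices_of_p_pos w.2) h).1)
    (orthonormalFamily_uniform (S := fun v : {v // 0 < t.p v} => t.peb v)
      (e := fun v c => (Sum.inl (A'.ans ((t.colorVertices c).idxOf v.1), c) : Label C t A'))
      (fun v => Finset.card_pos.1 v.2) fun v w c hv d hw h => by
        simp only [Sum.inl.injEq, Prod.mk.injEq] at h
        obtain ⟨h, rfl⟩ := h
        have hlt : ∀ u, c ∈ t.peb u → (t.colorVertices c).idxOf u < M := fun u hu =>
          (List.idxOf_lt_length_of_mem (mem_colorVertices.2 hu)).trans_le
            ((hc.count_le c).trans hM)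
        have := hA' (hlt _ hv) (hlt _ hw) h
        exact ⟨Subtype.ext ((List.idxOf_inj (mem_colorVertices.2 hv)).1 this), rfl⟩)
  exact ⟨U, fun v hv => hU ⟨v, hv⟩⟩

/-- A Hadamard operator on the extra bit where the parent is bare, and the identity elsewhere.
Conjugating a query by it writes the queried bit in the first case and leaves a phase in the second.
-/
theorem exists_query : ∃ H : Matrix.unitaryGroup (Label C t A') ℂ, ∀ v ∈ t.vertices, ∀ β,
    (t.ParentBare v → (H : Matrix (Label C t A') (Label C t A') ℂ) *ᵥ
      plusMinus (cell t A' v) β = ket (cell t A' v β)) ∧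
    (¬ t.ParentBare v → (H : Matrix (Label C t A') (Label C t A') ℂ) *ᵥ
      ket (cell t A' v β) = ket (cell t A' v β)) := by
  classical
  obtain ⟨U, hU⟩ := exists_unitary_map (κ := Bool × {v // v ∈ t.vertices})
    (g := fun r => ket (cell t A' r.2 r.1))
    (orthonormalFamily_columns (ι := Label C t A')
      (fun v : {v // v ∈ t.vertices} => if t.ParentBare v then hadamard else 1)
      (fun β v => cell t A' v β) fun β v γ w h => by
        have := cell_inj v.2 w.2 h
        exact ⟨this.2, Subtype.ext this.1⟩)
    (orthonormalFamily_ket fun r r' h => by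
      have := cell_inj r.2.2 r'.2.2 h
      exact Prod.ext this.2 (Subtype.ext this.1))
  refine ⟨U, fun v hv β => ⟨fun hb => ?_, fun hb => ?_⟩⟩
  · have := hU (β, ⟨v, hv⟩)
    simp only [if_pos hb] at this
    rwa [sum_hadamard_smul_ket] at this
  · have := hU (β, ⟨v, hv⟩)
    simp only [if_neg hb] at this
    have h1 : ∑ b', ((1 : Matrix.unitaryGroup Bool ℂ) : Matrix Bool Bool ℂ) b' β •
        ket (cell t A' v b') = ket (cell t A' v β) := by
      simp [Matrix.one_apply]
    rwa [h1] at this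

theorem query_of_parentBare {N : ℕ} (M : ℕ) (x : Fin N → Bool)
    {H : Matrix.unitaryGroup (Label C t A') ℂ} {v : List Bool} (hv : v ∈ t.vertices)
    (hb : t.ParentBare v)
    (hH : ∀ β, (H : Matrix (Label C t A') (Label C t A') ℂ) *ᵥ
      plusMinus (cell t A' v) β = ket (cell t A' v β)) :
    ((H : Matrix (Label C t A') (Label C t A') ℂ) * oracle (index N M) x *
      ((H⁻¹ : Matrix.unitaryGroup (Label C t A') ℂ) : Matrix (Label C t A') (Label C t A') ℂ)) *ᵥ
        ket (cell t A' v false) = ket (cell t A' v (bit x (t.rightmostLeaf (v ++ [false])))) := by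
  rw [← Matrix.mulVec_mulVec, ← Matrix.mulVec_mulVec, unitary_inv_mulVec H (hH false),
    oracle_mulVec_plusMinus, hH, index_cell N M hv, if_neg (by simp)]
  rw [index_cell N M hv, if_pos ⟨rfl, hb⟩]

theorem query_of_not_parentBare {N : ℕ} (M : ℕ) (x : Fin N → Bool)
    {H : Matrix.unitaryGroup (Label C t A') ℂ} {v : List Bool} (hv : v ∈ t.vertices)
    (hb : ¬ t.ParentBare v)
    (hH : (H : Matrix (Label C t A') (Label C t A') ℂ) *ᵥ
      ket (cell t A' v false) = ket (cell t A' v false)) :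
    ((H : Matrix (Label C t A') (Label C t A') ℂ) * oracle (index N M) x *
      ((H⁻¹ : Matrix.unitaryGroup (Label C t A') ℂ) : Matrix (Label C t A') (Label C t A') ℂ)) *ᵥ
        ket (cell t A' v false) =
      phase x (t.rightmostLeaf (v ++ [false])) • ket (cell t A' v false) := by
  rw [← Matrix.mulVec_mulVec, ← Matrix.mulVec_mulVec, unitary_inv_mulVec H hH,
    oracle_mulVec_ket, Matrix.mulVec_smul, hH, index_cell N M hv, if_neg fun h => hb h.2]

theorem exists_last (hc : t.IsFairTightCovering N') :
    ∃ U : Matrix.unitaryGroup (Label C t A') ℂ, ∀ v β, 0 < t.p v → (t.ParentBare v ∨ β = false) →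
      (U : Matrix (Label C t A') (Label C t A') ℂ) *ᵥ ket (cell t A' v β) =
        lastState t (leafLabel t A') v β := by
  obtain ⟨U, hU⟩ := exists_unitary_map
    (κ := {r : List Bool × Bool // 0 < t.p r.1 ∧ (t.ParentBare r.1 ∨ r.2 = false)})
    (f := fun r => ket (cell t A' r.1.1 r.1.2))
    (orthonormalFamily_ket fun r r' h => by
      have := cell_inj (mem_vertices_of_p_pos r.2.1) (mem_vertices_of_p_pos r'.2.1) h
      exact Subtype.ext (Prod.ext this.1 this.2))
    (hc.orthonormalFamily_lastState (leafLabel_injOn (A' := A')))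
  exact ⟨U, fun v β h h' => hU ⟨(v, β), h, h'⟩⟩

end StepCircuit

open PebbledTree StepCircuit in
/-- **One level of the recursion can be carried out.** -/
theorem exists_pebbleStep {C : Type} [Fintype C] [DecidableEq C] [Nonempty C] {N M N' : ℕ}
    {t : PebbledTree C} (hc : t.IsFairTightCovering N') (hM : N' ≤ M) {A' : Circuit}
    (hA' : Set.InjOn A'.ans (Set.Iio M)) : ∃ A : Circuit, Nonempty (PebbleStep N M t A' A) := by
  obtain ⟨prep, hprep⟩ := exists_prep (C := C) (t := t) (A' := A')
  choose lift hlift using exists_lift (C := C) (t := t) (A' := A')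
  obtain ⟨U₁, hU₁⟩ := exists_coloring hA' hc hM
  obtain ⟨H, hH⟩ := exists_query (C := C) (t := t) (A' := A')
  obtain ⟨U₂, hU₂⟩ := exists_last (A' := A') hc

  refine ⟨⟨Label C t A', inferInstance, inferInstance, A'.queries + 1, fun j =>
    if j ≤ A'.queries then
      (if j = A'.queries then H⁻¹ * U₁⁻¹ else 1) * lift j * (if j = 0 then prep else 1)
    else U₂ * H, index N M, leafLabel t A' 0, leafLabel t A'⟩, ⟨?_⟩⟩
  exact
    { reg := fun b c => Sum.inl (b, c)
      reg_inj := fun b c b' c' h => by simpa using h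
      reg_idx := fun b c h => if_pos h
      reg_idx' := fun b c h => (if_neg (not_lt.2 h)).ge
      vtx := fun v => cell t A' v false
      vtx_inj := fun v hv w hw h =>
        (cell_inj (mem_vertices_of_p_pos hv) (mem_vertices_of_p_pos hw) h).1
      vtxBit := cell t A'
      vtxBit_inj := fun v w β γ hv hw h =>
        cell_inj (mem_vertices_of_p_pos hv) (mem_vertices_of_p_pos hw) h
      leafState := leafLabel t A'
      leafState_inj := leafLabel_injOn
      ans_eq := fun _ _ => rfl
      prep := prep
      prep_spec := hprep
      lift := lift
      lift_spec := fun j _ => hlift j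
      U₁ := U₁
      U₁_spec := hU₁
      qPre := H⁻¹
      qPost := H
      query_bare := fun x v hv hb => query_of_parentBare M x (mem_vertices_of_p_pos hv) hb
        fun β => (hH v (mem_vertices_of_p_pos hv) β).1 hb
      query_pebbled := fun x v hv hb => query_of_not_parentBare M x (mem_vertices_of_p_pos hv) hb
        ((hH v (mem_vertices_of_p_pos hv) false).2 hb)
      U₂ := U₂
      U₂_bare_zero := fun v hv hb => (hU₂ v false hv (Or.inl hb)).trans (if_pos hb)
      U₂_bare_one := fun v hv hb => (hU₂ v true hv (Or.inl hb)).trans (if_pos hb)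
      U₂_pebbled := fun v hv hb => (hU₂ v false hv (Or.inr rfl)).trans (if_neg hb)
      queries_eq := rfl
      U_eq := fun j hj => if_pos hj
      U_last := if_neg (by omega) }

/-! ### The recursive search -/

instance nonempty_colors (L : ℕ) : Nonempty (Fin (numColors L)) :=
  ⟨⟨0, Nat.two_pow_pos _⟩⟩

/-! ### The size of the recursive input -/

theorem pebbleBound_le_recSize (N : ℕ) : pebbleBound (treeSize N) ≤ recSize N :=
  Nat.le_add_right _ _

theorem treeSize_le (N : ℕ) : treeSize N ≤ N + 1 := by
  rw [treeSize]; omega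

theorem le_treeSize (N : ℕ) : N ≤ treeSize N := Nat.le_add_right _ _

theorem even_treeSize (N : ℕ) : Even (treeSize N) := by
  rw [treeSize, Nat.even_iff]; omega

theorem recSize_le (N : ℕ) :
    (recSize N : ℝ) ≤ (treeSize N : ℝ) / 3 + Real.logb 2 (treeSize N) + 1 := by
  have h0 : (0 : ℝ) ≤ Real.logb 2 (treeSize N) := by
    rcases Nat.eq_zero_or_pos (treeSize N) with h | h
    · simp [h]
    · exact Real.logb_nonneg (by norm_num) (by exact_mod_cast h)
  have h1 : (pebbleBound (treeSize N) : ℝ) ≤ (treeSize N : ℝ) / 3 + Real.logb 2 (treeSize N) :=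
    Nat.floor_le (by positivity)
  have h2 : recSize N ≤ pebbleBound (treeSize N) + 1 := by
    rw [recSize]; omega
  have h3 : (recSize N : ℝ) ≤ pebbleBound (treeSize N) + 1 := by exact_mod_cast h2
  linarith

/-- The tangent of the natural logarithm at 8, combined with 1 / log 2 ≤ 2. -/
theorem logb_two_le {x : ℝ} (hx : 8 ≤ x) : Real.logb 2 x ≤ x / 4 + 1 := by
  have h2 : (1 : ℝ) / 2 ≤ Real.log 2 := by linarith [Real.log_two_gt_d9]
  have h8 : Real.log 8 = 3 * Real.log 2 := by
    rw [show (8 : ℝ) = 2 ^ 3 by norm_num, Real.log_pow]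
    norm_num
  have h1 : Real.log x ≤ x / 8 - 1 + 3 * Real.log 2 := by
    have := Real.log_le_sub_one_of_pos (show 0 < x / 8 by linarith)
    rw [Real.log_div (by linarith) (by norm_num), h8] at this
    linarith
  rw [Real.logb, div_le_iff₀ (by linarith)]
  nlinarith

/-- The recursion terminates: (N + 1)/3 + (N + 1)/4 + 2 is already less than N in this range. -/
theorem recSize_lt {N : ℕ} (hN : 8 < N) : recSize N < N := by
  have h1 := recSize_le N
  have h2 : (8 : ℝ) < N := by exact_mod_cast hN
  have h3 : (treeSize N : ℝ) ≤ N + 1 := by exact_mod_cast treeSize_le N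
  have h4 : (N : ℝ) ≤ treeSize N := by exact_mod_cast le_treeSize N
  have h5 := logb_two_le (h2.le.trans h4)
  have : (recSize N : ℝ) < N := by linarith
  exact_mod_cast this

theorem recSize_pos {N : ℕ} (hN : 8 < N) : 1 ≤ recSize N := by
  refine le_trans (Nat.le_floor ?_) (pebbleBound_le_recSize N)
  have h : (8 : ℝ) < treeSize N := by exact_mod_cast hN.trans_le (le_treeSize N)
  have := Real.logb_nonneg (b := 2) (by norm_num) (show (1 : ℝ) ≤ treeSize N by linarith)
  push_cast
  linarith

/-! ### Correctness and existence of the recursive search -/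

theorem IsPebbleSearch.searchesExactly {N : ℕ} {A : Circuit} (h : IsPebbleSearch N A) :
    A.SearchesExactly N := by
  induction h with
  | base N A hN hN' hA hq => exact hA
  | step N hN t ht hc A' A hA' hA ih =>
    exact hA.searchesExactly hc (ht.trans_le (treeSize_le N)) ((le_treeSize N).trans ht.ge)
      (pebbleBound_le_recSize N) ih

theorem exists_isPebbleSearch {N : ℕ} (hN : 1 ≤ N) : ∃ A, IsPebbleSearch N A := by
  induction N using Nat.strong_induction_on with
  | _ N ih =>
    rcases le_or_gt N 8 with h8 | h8
    · obtain ⟨A, hA, hq⟩ := exists_binarySearch h8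
      exact ⟨A, .base N A hN h8 hA hq⟩
    · obtain ⟨A', hA'⟩ := ih (recSize N) (recSize_lt h8) (recSize_pos h8)
      obtain ⟨t, ht, hc⟩ := PebbledTree.exists_isFairTightCovering (even_treeSize N)
        (by have := le_treeSize N; omega)
      obtain ⟨A, ⟨hA⟩⟩ := exists_pebbleStep (N := N) hc (pebbleBound_le_recSize N)
        hA'.searchesExactly.1
      exact ⟨A, .step N h8 t ht hc A' A hA' hA⟩

/-! ### The number of queries -/

/-- A crude bound, needed only for bounded sizes: every level costs one query and makes the input
strictly shorter. -/
theorem IsPebbleSearch.queries_le_add {N : ℕ} {A : Circuit} (h : IsPebbleSearch N A) :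
    A.queries ≤ N + 3 := by
  induction h with
  | base N A hN hN' hA hq => omega
  | step N hN t ht hc A' A hA' hA ih =>
    have := recSize_lt hN
    rw [hA.queries_eq]
    omega

/-- The linear term absorbs the logarithm: L/3 is at most 3^k + k + 16/3 and log₂ L is at most 2k +
5. With 1 for rounding to an even number, the constants add up to 34/3 < 12. -/
theorem recSize_le_of_le {N k : ℕ} (hN : 8 < N) (h : N ≤ 3 ^ (k + 1) + 3 * (k + 1) + 12) :
    recSize N ≤ 3 ^ k + 3 * k + 12 := by
  have hL : treeSize N ≤ 3 * 3 ^ k + 3 * k + 16 := by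
    have := treeSize_le N
    rw [pow_succ] at h
    omega
  have hpos : 0 < treeSize N := by
    have := le_treeSize N
    omega
  have hk : k < 3 ^ k := Nat.lt_pow_self (by norm_num)
  -- Since k < 3^k ≤ 4^k, the bound on L is at most 6·4^k + 16, hence at most 32·4^k.
  have hpow : treeSize N ≤ 2 ^ (2 * k + 5) := by
    have h34 : 3 ^ k ≤ 4 ^ k := Nat.pow_le_pow_left (by norm_num) k
    rw [pow_add, pow_mul]
    norm_num
    omega
  have hlog : Real.logb 2 (treeSize N) ≤ ((2 * k + 5 : ℕ) : ℝ) := by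
    rw [Real.logb_le_iff_le_rpow (by norm_num) (by exact_mod_cast hpos), Real.rpow_natCast]
    exact_mod_cast hpow
  have hL' : (treeSize N : ℝ) ≤ 3 * 3 ^ k + 3 * k + 16 := by exact_mod_cast hL
  have h1 := recSize_le N
  push_cast at hlog
  have : (recSize N : ℝ) ≤ 3 ^ k + 3 * k + 12 := by linarith
  exact_mod_cast this

/-- Each level lowers k by one. At k = 0 the size is at most 13, and the crude bound gives 16
queries. -/
theorem IsPebbleSearch.queries_le {N : ℕ} {A : Circuit} (h : IsPebbleSearch N A) {k : ℕ}
    (hk : N ≤ 3 ^ k + 3 * k + 12) : A.queries ≤ k + 16 := by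
  induction h generalizing k with
  | base N A hN hN' hA hq => omega
  | step N hN t ht hc A' A hA' hA ih =>
    rcases k with _ | k
    · have := (IsPebbleSearch.step N hN t ht hc A' A hA' hA).queries_le_add
      simp at hk
      omega
    · have := ih (recSize_le_of_le hN hk)
      rw [hA.queries_eq]
      omega

/-- Taking k as log₃ N rounded up costs at most one query beyond the constant 16. -/
theorem IsPebbleSearch.queries_le_logb {N : ℕ} {A : Circuit} (h : IsPebbleSearch N A)
    (hN : 1 ≤ N) : (A.queries : ℝ) ≤ Real.logb 3 N + 17 := by
  have h0 : 0 ≤ Real.logb 3 N := Real.logb_nonneg (by norm_num) (by exact_mod_cast hN)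
  have hpow : N ≤ 3 ^ ⌈Real.logb 3 N⌉₊ := by
    have := Nat.le_ceil (Real.logb 3 N)
    rw [Real.logb_le_iff_le_rpow (by norm_num) (by exact_mod_cast hN), Real.rpow_natCast] at this
    exact_mod_cast this
  have h1 := h.queries_le (k := ⌈Real.logb 3 N⌉₊) (by omega)
  have h2 : (A.queries : ℝ) ≤ ⌈Real.logb 3 N⌉₊ + 16 := by exact_mod_cast h1
  linarith [Nat.ceil_lt_add_one h0]

end OrderedSearch

end

theorem theorem4 :
    ∃ K : ℝ, ∀ N : ℕ, 1 ≤ N →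
      (∃ B : OrderedSearch.BlackBoxAlgorithm, OrderedSearch.IsPebbleSearchAlgorithm N B) ∧
      ∀ B : OrderedSearch.BlackBoxAlgorithm, OrderedSearch.IsPebbleSearchAlgorithm N B →
        B.Computes (OrderedSearch.orderedInputs N) (Nat.clog 2 N)
            OrderedSearch.leftmostOne 0 ∧
          (B.T : ℝ) ≤ Real.logb 3 N + K := by
  refine ⟨17, fun N hN => ⟨?_, ?_⟩⟩
  · obtain ⟨A, hA⟩ := OrderedSearch.exists_isPebbleSearch hN
    obtain ⟨B, hB⟩ := OrderedSearch.exists_implements hA.searchesExactly.1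
    exact ⟨B, A, hA, hB⟩
  · rintro B ⟨A, hA, hB⟩
    refine ⟨hB.computes hA.searchesExactly, ?_⟩
    rw [hB.1]
    exact hA.queries_le_logb hN
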